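/- Let $\alpha,\beta,\gamma,\Lambda\in\mathbb R$ with $\alpha=3\beta$. For the metric $ds^2=-f(r)\,dt^2+dr^2/f(r)+R_0^2(d\theta^2+\sin^2\theta\,d\phi^2)$, $R_0>0$, the vacuum field equations of quadratic gravity (action density $\gamma(R-2\Lambda)+\beta R^2-\alpha C_{abcd}C^{abcd}$) are $$\begin{aligned} E_{tt}&:\ R_0^4(\alpha-3\beta)(-4ff^{(4)}+f''^2-2f^{(3)}f')-6\gamma\Lambda R_0^4+6\gamma R_0^2-4\alpha+12\beta=0,\\ E_{rr}&:\ R_0^4(\alpha-3\beta)(f''^2-2f^{(3)}f')-6\gamma\Lambda R_0^4+6\gamma R_0^2-4\alpha+12\beta=0,\\ E_{\theta\theta}&:\ R_0^4\big[(\alpha-3\beta)f''^2+3\gamma f''-2(\alpha+6\beta)(ff^{(4)}+f^{(3)}f')\big]+6\gamma\Lambda R_0^4-4\alpha+12\beta=0. \end{aligned}$$ **Reduction.** On any nonempty set of values of $r$, these three equations hold if and only if ($\gamma=0$ or $R_0^2=1/\Lambda$) and the reduced equation $$2\gamma\Lambda+\gamma f''-6\beta\,(ff^{(4)}+f^{(3)}f')=0\qquad(*)$$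 holds there. (Thus $R_0^2=1/\Lambda$ when $\gamma\ne0$.) Consider formal generalized power series $f=\Delta^p\sum_{i\ge0}a_i\Delta^i$ with $\Delta=r-r_0$, $p\in\mathbb R$, $a_i\in\mathbb R$, differentiated termwise. We call $f$ a *solution with exponent $p$* if $a_0\neq0$ and $f$ satisfies $(*)$ formally. If $\sum a_ix^i$ converges for $|x|<\rho$, where $\rho>0$, then the function $f(r)=(r-r_0)^p\sum a_i(r-r_0)^i$ satisfies $(*)$ on $(r_0,r_0+\rho)$ if and only if the series satisfies $(*)$ formally. Moreover: 1. **Exponents.** If $(\beta,\gamma)\ne(0,0)$, every solution has $p\in\{0,1,\tfrac32,2\}$. 2. **$p=\tfrac32$.** If $(\beta,\gamma)\neq(0,0)$, then $(a_i)$ is a solution with exponent $\frac32$ if and only if $a_0\ne0$, $\gamma=0$ and $a_i=0$ for all $i\ge1$, i.e. $f=a_0\Delta^{3/2}$. 3. **$p=2$.** Let $\beta\ne0$, $\gamma\neq0$. Then $(a_i)$ is a solution with exponent $2$ if and only if $a_0\neq 0$, $a_0=-\Lambda$, and either $a_i=0$ for all $i\ge1$ (Nariai), or for some integer $L\ge1$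 one has $$\Lambda=-\frac{\gamma}{6\beta L(L+1)},\qquad a_i=0\ (1\le i<L),\qquad a_l=\frac{6\beta\sum_{j=1}^{l-1}a_ja_{l-j}(j+2)(j+1)j}{(l+2)[\gamma+6\beta\Lambda l(l+1)]}\ (l>L).$$ For each $L\ge1$ with $\Lambda=-\gamma/(6\beta L(L+1))$: the brackets $\gamma+6\beta\Lambda l(l+1)$, $l>L$, are nonzero; for every $c\in\mathbb R$ there is exactly one solution with exponent $2$ and $a_L=c$; and if $a_L\ne0$, then $a_l\neq0$ exactly when $L\mid l$. 4. **$p=1$.** Let $\beta\ne0$. Then $(a_i)$ is a solution with exponent $1$ if and only if $a_0\ne0$, $a_2=\dfrac{\gamma(a_1+\Lambda)}{18\beta a_0}$ and, for all $l\ge1$, $$a_{l+2}=\frac{\gamma a_{l+1}(l+2)-6\beta\sum_{j=1}^{l+1}a_ja_{l+2-j}\,j(j+1)(j-1)}{6\beta a_0(l+3)(l+2)(l+1)}.$$ The parameters $a_0\neq0$ and $a_1$ are free: for each choice there is exactly one solution. Every solution satisfies $$a_3=-\frac{\gamma(a_1+\Lambda)(12\beta a_1-\gamma)}{864\beta^2a_0^2},\quad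 a_4=\frac{\gamma(a_1+\Lambda)(432\beta^2a_1^2-72\beta\gamma a_1+\gamma^2-24\beta\gamma\Lambda)}{77760\beta^3a_0^3},$$ and $a_i=0$ for all $i\ge2$ if $a_1=-\Lambda$ or $\gamma=0$. 5. **$p=0$.** Let $\beta\ne0$. Then $(a_i)$ is a solution with exponent $0$ if and only if $a_0\neq0$, $a_4=-\dfrac{a_1a_3}{4a_0}+\dfrac{\gamma(a_2+\Lambda)}{72\beta a_0}$ and, for all $l\ge1$, $$a_{l+4}=\frac{\gamma a_{l+2}(l+2)-6\beta\sum_{j=1}^{l+3}a_ja_{l+4-j}\,j(j-1)(j-2)}{6\beta a_0(l+4)(l+3)(l+2)}.$$ The parameters $a_0\ne0$, $a_1,a_2,a_3$ are free: for each choice there is exactly one solution. Every solution satisfies $$a_5=-\frac{a_3(a_0a_2-a_1^2)}{10a_0^2}+\frac{\gamma[3a_0a_3-2a_1(a_2+\Lambda)]}{360\beta a_0^2},$$ $$a_6=-\frac{a_3^2}{20a_0}+\frac{a_1a_3[9\beta(2a_0a_2-a_1^2)-\gamma a_0]}{180\beta a_0^3}-\frac{\gamma(a_2+\Lambda)[36\beta(a_0a_2-a_1^2)-\gamma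 a_0]}{12960\beta^2a_0^3},$$ and $a_i=0$ for all $i\ge3$ if $a_3=0$ and ($a_2=-\Lambda$ or $\gamma=0$). -/

import Mathlib

/-! ### Quadratic gravity on `ds² = -f dt² + dr²/f + R₀² dΩ²` -/

/-- The `tt` component of the vacuum field equations of quadratic gravity for the metric
`-f dt² + dr²/f + R₀² dΩ²`, up to a nonvanishing factor. -/
noncomputable def fieldTT (α β γ Λ R₀ : ℝ) (f : ℝ → ℝ) (r : ℝ) : ℝ :=
  R₀ ^ 4 * (α - 3 * β) *
      (-4 * f r * iteratedDeriv 4 f r + iteratedDeriv 2 f r ^ 2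
        - 2 * iteratedDeriv 3 f r * deriv f r)
    - 6 * γ * Λ * R₀ ^ 4 + 6 * γ * R₀ ^ 2 - 4 * α + 12 * β

/-- The `rr` component of the field equations. -/
noncomputable def fieldRR (α β γ Λ R₀ : ℝ) (f : ℝ → ℝ) (r : ℝ) : ℝ :=
  R₀ ^ 4 * (α - 3 * β) *
      (iteratedDeriv 2 f r ^ 2 - 2 * iteratedDeriv 3 f r * deriv f r)
    - 6 * γ * Λ * R₀ ^ 4 + 6 * γ * R₀ ^ 2 - 4 * α + 12 * β

/-- The `θθ` component of the field equations. -/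
noncomputable def fieldThetaTheta (α β γ Λ R₀ : ℝ) (f : ℝ → ℝ) (r : ℝ) : ℝ :=
  R₀ ^ 4 *
      ((α - 3 * β) * iteratedDeriv 2 f r ^ 2 + 3 * γ * iteratedDeriv 2 f r
        - 2 * (α + 6 * β) *
          (f r * iteratedDeriv 4 f r + iteratedDeriv 3 f r * deriv f r))
    + 6 * γ * Λ * R₀ ^ 4 - 4 * α + 12 * β

/-- The left-hand side of the reduced equation
`2γΛ + γ f'' - 6β (f f'''' + f''' f') = 0` for a real function `f`. -/
noncomputable def reducedODE (β γ Λ : ℝ) (f : ℝ → ℝ) (r : ℝ) : ℝ :=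
  2 * γ * Λ + γ * iteratedDeriv 2 f r
    - 6 * β * (f r * iteratedDeriv 4 f r + iteratedDeriv 3 f r * deriv f r)

/-! ### Generalized power series

Formal generalized power series in `Δ` with real exponents are Hahn series; the coefficient of
`Δ ^ e` in `F` is `F.coeff e`. -/

/-- The formal derivative `d/dΔ`, termwise `c Δ ^ e ↦ c e Δ ^ (e - 1)`. -/
noncomputable def formalDeriv (F : HahnSeries ℝ ℝ) : HahnSeries ℝ ℝ where
  coeff e := (e + 1) * F.coeff (e + 1)
  isPWO_support' := by
    have h := F.isPWO_support.image_of_monotone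
      (f := fun x : ℝ => x - 1) (fun x y hxy => sub_le_sub_right hxy 1)
    refine h.mono ?_
    intro e he
    exact ⟨e + 1, fun h0 => he (by simp [h0]), by simp⟩

/-- The series `Δ ^ p * ∑ i, a i * Δ ^ i`. -/
noncomputable def frobeniusSeries (p : ℝ) (a : ℕ → ℝ) : HahnSeries ℝ ℝ :=
  HahnSeries.single p 1 * HahnSeries.ofPowerSeries ℝ ℝ (PowerSeries.mk a)

/-- The left-hand side of the reduced equation for a formal generalized power series. -/
noncomputable def formalReducedODE (β γ Λ : ℝ) (F : HahnSeries ℝ ℝ) : HahnSeries ℝ ℝ :=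
  HahnSeries.C (2 * γ * Λ) + γ • formalDeriv^[2] F
    - (6 * β) • (F * formalDeriv^[4] F + formalDeriv^[3] F * formalDeriv F)

/-- `Δ ^ p * ∑ i, a i * Δ ^ i`, with `a 0 ≠ 0`, solves the reduced equation. -/
def IsFrobeniusSolution (β γ Λ p : ℝ) (a : ℕ → ℝ) : Prop :=
  a 0 ≠ 0 ∧ formalReducedODE β γ Λ (frobeniusSeries p a) = 0

/-! The nonlinear term is an exact derivative, `f f'''' + f''' f' = (f f''')'`, so its coefficient
at exponent `2p - 4 + n` is `2p + n - 3` times one convolution sum (`quadraticCoeff`). The equation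
thus compares three blocks: a constant at exponent `0`, `γ f''` from `p - 2` on, and the quadratic
block from `2p - 4` on.

Lowest exponents restrict `p`. For `p < 2` the quadratic block stands alone at `2p - 4`, so `(2p -
3) p (p - 1) (p - 2)` must vanish. For `p > 2` the block `γ f''` stands alone at `p - 2`, which
forces `γ = 0` outside the listed exponents, and then the same indicial polynomial decides. For `p =
3/2` the two blocks never meet, so again `γ = 0`.

For `p = 0, 1, 2` all exponents share one lattice. Comparing coefficients and cancelling the factor
`2p + n - 3` gives recursions. For `p = 0, 1` the newest coefficient has a nonzero multiplier, so
the initial data determine the series. For `p = 2` linear and quadratic blocks start together and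
the multiplier contains `γ + 6βΛ l(l+1)`; a nonconstant series needs it to vanish at its first
nonzero index `L`. Thereafter only multiples of `L` are reached, and `pos_of_resonance` excludes
cancellation there by tracking signs.

Formal and actual solutions agree because convergent series can be differentiated and multiplied
termwise and have unique coefficients (`eq_zero_of_hasEval_zero`). -/

/-! ### Arithmetic of generalized power series -/

theorem frobeniusSeries_coeff_add (p : ℝ) (a : ℕ → ℝ) (n : ℕ) :
    (frobeniusSeries p a).coeff (p + n) = a n := by
  have h := HahnSeries.coeff_single_mul (Γ' := ℝ) (R := ℝ) (r := 1)
    (x := HahnSeries.ofPowerSeries ℝ ℝ (PowerSeries.mk a)) (a := p + n) (b := p)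
  rw [frobeniusSeries, h, add_sub_cancel_left, HahnSeries.ofPowerSeries_apply_coeff]
  simp

theorem frobeniusSeries_coeff_of_forall_ne {p e : ℝ} (a : ℕ → ℝ) (h : ∀ n : ℕ, e ≠ p + n) :
    (frobeniusSeries p a).coeff e = 0 := by
  have h' := HahnSeries.coeff_single_mul (Γ' := ℝ) (R := ℝ) (r := 1)
    (x := HahnSeries.ofPowerSeries ℝ ℝ (PowerSeries.mk a)) (a := e) (b := p)
  rw [frobeniusSeries, h', one_mul, HahnSeries.ofPowerSeries_apply]
  refine HahnSeries.embDomain_of_notMem_range ?_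
  rintro ⟨n, hn⟩
  apply h n
  simp at hn
  linarith

/-- A Hahn series supported on `p + ℕ` is determined by its coefficients there. -/
theorem eq_frobeniusSeries {p : ℝ} {a : ℕ → ℝ} {F : HahnSeries ℝ ℝ}
    (h₁ : ∀ n : ℕ, F.coeff (p + n) = a n) (h₂ : ∀ e, (∀ n : ℕ, e ≠ p + n) → F.coeff e = 0) :
    F = frobeniusSeries p a := by
  ext e
  by_cases he : ∃ n : ℕ, e = p + n
  · obtain ⟨n, rfl⟩ := he
    rw [h₁, frobeniusSeries_coeff_add]
  · push Not at he
    rw [h₂ e he, frobeniusSeries_coeff_of_forall_ne a he]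

theorem frobeniusSeries_eq_zero_iff {p : ℝ} {a : ℕ → ℝ} :
    frobeniusSeries p a = 0 ↔ ∀ n, a n = 0 := by
  refine ⟨fun h n => by rw [← frobeniusSeries_coeff_add p a n, h]; rfl, fun h => ?_⟩
  exact (eq_frobeniusSeries (fun n => by simp [h]) (fun _ _ => rfl)).symm

theorem formalDeriv_frobeniusSeries (p : ℝ) (a : ℕ → ℝ) :
    formalDeriv (frobeniusSeries p a) = frobeniusSeries (p - 1) (fun i => (p + i) * a i) := by
  refine eq_frobeniusSeries (fun n => ?_) (fun e he => ?_)
  · have : p - 1 + n + 1 = p + n := by ring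
    simp only [formalDeriv, this, frobeniusSeries_coeff_add]
  · simp only [formalDeriv]
    rw [frobeniusSeries_coeff_of_forall_ne a, mul_zero]
    intro n hn
    exact he n (by linarith)

theorem frobeniusSeries_mul (p q : ℝ) (a b : ℕ → ℝ) :
    frobeniusSeries p a * frobeniusSeries q b = frobeniusSeries (p + q)
      (fun n => ∑ x ∈ Finset.HasAntidiagonal.antidiagonal n, a x.1 * b x.2) := by
  have h : PowerSeries.mk (fun n => ∑ x ∈ Finset.HasAntidiagonal.antidiagonal n, a x.1 * b x.2) =
      PowerSeries.mk a * PowerSeries.mk b := by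
    ext n
    simp [PowerSeries.coeff_mul]
  have h1 : (HahnSeries.single (p + q) 1 : HahnSeries ℝ ℝ) =
      HahnSeries.single p 1 * HahnSeries.single q 1 := by
    simp [HahnSeries.single_mul_single]
  rw [frobeniusSeries, frobeniusSeries, frobeniusSeries, h, map_mul, h1]
  ring

theorem frobeniusSeries_add (p : ℝ) (a b : ℕ → ℝ) :
    frobeniusSeries p a + frobeniusSeries p b = frobeniusSeries p (fun n => a n + b n) :=
  eq_frobeniusSeries (fun n => by simp [frobeniusSeries_coeff_add])
    (fun e he => by simp [frobeniusSeries_coeff_of_forall_ne _ he])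

theorem frobeniusSeries_sub (p : ℝ) (a b : ℕ → ℝ) :
    frobeniusSeries p a - frobeniusSeries p b = frobeniusSeries p (fun n => a n - b n) :=
  eq_frobeniusSeries (fun n => by simp [frobeniusSeries_coeff_add])
    (fun e he => by simp [frobeniusSeries_coeff_of_forall_ne _ he])

theorem smul_frobeniusSeries (c p : ℝ) (a : ℕ → ℝ) :
    c • frobeniusSeries p a = frobeniusSeries p (fun n => c * a n) :=
  eq_frobeniusSeries (fun n => by simp [frobeniusSeries_coeff_add])
    (fun e he => by simp [frobeniusSeries_coeff_of_forall_ne _ he])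

/-- Rewrites blocks with different leading exponents over a common one, so that they can be added
coefficientwise. -/
theorem frobeniusSeries_shift {p q : ℝ} (k : ℕ) (h : q = p + k) (a : ℕ → ℝ) :
    frobeniusSeries q a = frobeniusSeries p (fun n => if k ≤ n then a (n - k) else 0) := by
  subst h
  refine eq_frobeniusSeries (fun n => ?_) (fun e he => ?_)
  · split_ifs with hk
    · obtain ⟨m, rfl⟩ := Nat.exists_eq_add_of_le hk
      rw [Nat.add_sub_cancel_left, ← frobeniusSeries_coeff_add (p + k) a m]
      congr 1
      push_cast
      ring
    · refine frobeniusSeries_coeff_of_forall_ne a fun m hm => hk ?_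
      have : (n : ℝ) = ((k + m : ℕ) : ℝ) := by push_cast; linarith
      have := Nat.cast_injective this
      omega
  · refine frobeniusSeries_coeff_of_forall_ne a fun m hm => he (k + m) ?_
    push_cast
    linarith

theorem C_eq_frobeniusSeries {p : ℝ} (m : ℕ) (h : p + m = 0) (c : ℝ) :
    (HahnSeries.C c : HahnSeries ℝ ℝ) = frobeniusSeries p (fun n => if n = m then c else 0) := by
  rw [HahnSeries.C_apply]
  refine eq_frobeniusSeries (fun n => ?_) (fun e he => ?_)
  · split_ifs with hn
    · rw [hn, h, HahnSeries.coeff_single_same]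
    · refine HahnSeries.coeff_single_of_ne fun h' => hn ?_
      have : (n : ℝ) = m := by linarith
      exact Nat.cast_injective this
  · refine HahnSeries.coeff_single_of_ne fun h' => he m ?_
    rw [h', h]

/-- The coefficients of the quadratic term `f f'''' + f''' f' = (f f''')'`. -/
noncomputable def quadraticCoeff (p : ℝ) (a : ℕ → ℝ) (n : ℕ) : ℝ :=
  (2 * p + n - 3) * ∑ x ∈ Finset.HasAntidiagonal.antidiagonal n,
    a x.1 * a x.2 * (p + x.2) * (p + x.2 - 1) * (p + x.2 - 2)

/-- The two sums combine through `(p - 3 + j) + (p + i) = 2p + n - 3`, which is constant on the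
antidiagonal and factors out; this is the outer derivative in `(f f''')'`. -/
theorem sum_antidiagonal_eq_quadraticCoeff (p : ℝ) (a : ℕ → ℝ) (n : ℕ) :
    (∑ x ∈ Finset.HasAntidiagonal.antidiagonal n, a x.1 *
        ((p - 3 + x.2) * ((p - 2 + x.2) * ((p - 1 + x.2) * ((p + x.2) * a x.2))))) +
      ∑ x ∈ Finset.HasAntidiagonal.antidiagonal n, (p + x.1) * a x.1 *
        ((p - 2 + x.2) * ((p - 1 + x.2) * ((p + x.2) * a x.2))) = quadraticCoeff p a n := by
  rw [quadraticCoeff, Finset.mul_sum, ← Finset.sum_add_distrib]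
  refine Finset.sum_congr rfl fun x hx => ?_
  rw [← Finset.HasAntidiagonal.mem_antidiagonal.1 hx]
  push_cast
  ring

theorem formalDeriv_iterate_two (p : ℝ) (a : ℕ → ℝ) :
    formalDeriv^[2] (frobeniusSeries p a) =
      frobeniusSeries (p - 2) (fun i => (p - 1 + i) * ((p + i) * a i)) := by
  simp only [Function.iterate_succ, Function.iterate_zero, Function.comp_apply, id,
    formalDeriv_frobeniusSeries]
  congr 1; ring

theorem formalDeriv_iterate_three (p : ℝ) (a : ℕ → ℝ) :
    formalDeriv^[3] (frobeniusSeries p a) =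
      frobeniusSeries (p - 3) (fun i => (p - 2 + i) * ((p - 1 + i) * ((p + i) * a i))) := by
  rw [Function.iterate_succ_apply', formalDeriv_iterate_two, formalDeriv_frobeniusSeries]
  congr 1; ring

theorem formalDeriv_iterate_four (p : ℝ) (a : ℕ → ℝ) :
    formalDeriv^[4] (frobeniusSeries p a) = frobeniusSeries (p - 4)
      (fun i => (p - 3 + i) * ((p - 2 + i) * ((p - 1 + i) * ((p + i) * a i)))) := by
  rw [Function.iterate_succ_apply', formalDeriv_iterate_three, formalDeriv_frobeniusSeries]
  congr 1; ring

theorem formalReducedODE_frobeniusSeries (β γ Λ p : ℝ) (a : ℕ → ℝ) :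
    formalReducedODE β γ Λ (frobeniusSeries p a) = HahnSeries.C (2 * γ * Λ) +
      frobeniusSeries (p - 2) (fun i => γ * ((p - 1 + i) * ((p + i) * a i))) -
      frobeniusSeries (2 * p - 4) (fun n => 6 * β * quadraticCoeff p a n) := by
  rw [formalReducedODE, formalDeriv_iterate_two, formalDeriv_iterate_three,
    formalDeriv_iterate_four, formalDeriv_frobeniusSeries, frobeniusSeries_mul, mul_comm
    (frobeniusSeries (p - 3) _), frobeniusSeries_mul, show p + (p - 4) = 2 * p - 4 by ring,
    show p - 1 + (p - 3) = 2 * p - 4 by ring, frobeniusSeries_add, smul_frobeniusSeries,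
    smul_frobeniusSeries]
  simp only [sum_antidiagonal_eq_quadraticCoeff]

/-- For `p = 2 - k` all exponents in the equation lie in `2p - 4 + ℕ`. -/
theorem formalReducedODE_eq_zero_iff {p : ℝ} (k : ℕ) (hp : p = 2 - k) (β γ Λ : ℝ) (a : ℕ → ℝ) :
    formalReducedODE β γ Λ (frobeniusSeries p a) = 0 ↔
      ∀ n, (if n = 2 * k then 2 * γ * Λ else 0) +
        (if k ≤ n then γ * ((p - 1 + (n - k : ℕ)) * ((p + (n - k : ℕ)) * a (n - k))) else 0) -
        6 * β * quadraticCoeff p a n = 0 := by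
  rw [formalReducedODE_frobeniusSeries,
    C_eq_frobeniusSeries (p := 2 * p - 4) (2 * k) (by rw [hp]; push_cast; ring),
    frobeniusSeries_shift (p := 2 * p - 4) (q := p - 2) k (by rw [hp]; ring),
    frobeniusSeries_add, frobeniusSeries_sub, frobeniusSeries_eq_zero_iff]

open Filter Topology

/-! ### Convergent generalized power series -/

/-- The sum `x ^ p * ∑ i, a i * x ^ i` as a function of `x`. -/
noncomputable def frobeniusSum (p : ℝ) (a : ℕ → ℝ) (x : ℝ) : ℝ :=
  x ^ p * ∑' i : ℕ, a i * x ^ i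

/-- The power series with coefficients `a` converges on `|x| < ρ`. -/
def ConvergesOn (ρ : ℝ) (a : ℕ → ℝ) : Prop :=
  ∀ x : ℝ, |x| < ρ → Summable fun i : ℕ => a i * x ^ i

/-- Termwise differentiation keeps the radius: at a point `y` between `|x|` and `ρ` the series
converges, and the linear factor is absorbed by `(x / y) ^ i`. -/
theorem ConvergesOn.add_natCast_mul {ρ : ℝ} {a : ℕ → ℝ} (h : ConvergesOn ρ a) (p : ℝ) :
    ConvergesOn ρ (fun i => (p + i) * a i) := by
  intro x hx
  have hx0 := abs_nonneg x
  obtain ⟨y, hxy, hyρ⟩ := exists_between hx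
  have hy : 0 < y := hx0.trans_lt hxy
  have hs := (h y (by rwa [abs_of_pos hy])).abs
  have hq : |x / y| < 1 := by rwa [abs_div, abs_of_pos hy, div_lt_one hy]
  have ht : Tendsto (fun i : ℕ => (p + i) * (x / y) ^ i) atTop (𝓝 0) := by
    have h1 := (tendsto_pow_atTop_nhds_zero_of_abs_lt_one hq).const_mul p
    have h2 := tendsto_pow_const_mul_const_pow_of_abs_lt_one 1 hq
    have h3 := h1.add h2
    simp only [mul_zero, add_zero, pow_one] at h3
    refine h3.congr fun i => by ring
  refine summable_of_isBigO_nat hs ?_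
  have hb := (Asymptotics.isBigO_refl (fun i : ℕ => a i * y ^ i) atTop).abs_right.mul
    (ht.isBigO_one ℝ)
  simp only [mul_one] at hb
  refine hb.congr_left fun i => ?_
  rw [div_pow]
  field_simp

theorem ConvergesOn.hasDerivAt_tsum {ρ : ℝ} {a : ℕ → ℝ} (h : ConvergesOn ρ a) {x : ℝ}
    (hx : |x| < ρ) :
    HasDerivAt (fun z => ∑' i : ℕ, a i * z ^ i) (∑' i : ℕ, a i * (i * x ^ (i - 1))) x := by
  obtain ⟨y, hxy, hyρ⟩ := exists_between hx
  have hy : 0 < y := (abs_nonneg x).trans_lt hxy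
  have hs : Summable fun i : ℕ => |a i * (i * y ^ (i - 1))| := by
    have h1 := ((h.add_natCast_mul 0) y (by rwa [abs_of_pos hy])).mul_right y⁻¹
    refine (h1.congr fun i => ?_).abs
    rcases i with _ | i
    · simp
    · simp only [Nat.add_sub_cancel, pow_succ]
      field_simp
      ring
  refine hasDerivAt_tsum_of_isPreconnected (t := Metric.ball 0 y) (y₀ := x) hs Metric.isOpen_ball
    (convex_ball _ _).isPreconnected (fun i z _ => (hasDerivAt_pow i z).const_mul (a i))
    (fun i z hz => ?_) (by simpa using hxy) (h x hx) (by simpa using hxy)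
  have hz' : |z| ≤ y := by simpa using (Metric.mem_ball.1 hz).le
  rw [Real.norm_eq_abs, abs_mul, abs_mul, abs_mul, abs_mul, abs_pow, abs_pow, abs_of_pos hy]
  gcongr

theorem ConvergesOn.hasDerivAt_frobeniusSum {ρ : ℝ} {a : ℕ → ℝ} (h : ConvergesOn ρ a) (p : ℝ)
    {x : ℝ} (hx0 : 0 < x) (hx : x < ρ) :
    HasDerivAt (frobeniusSum p a) (frobeniusSum (p - 1) (fun i => (p + i) * a i) x) x := by
  have hx' : |x| < ρ := by rwa [abs_of_pos hx0]
  have h1 := (Real.hasDerivAt_rpow_const (p := p) (Or.inl hx0.ne')).mul (h.hasDerivAt_tsum hx')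
  refine h1.congr_deriv ?_
  have hp : x ^ p = x ^ (p - 1) * x := by
    rw [← Real.rpow_add_one hx0.ne', sub_add_cancel]
  have h2 : x * ∑' i : ℕ, a i * (i * x ^ (i - 1)) = ∑' i : ℕ, (0 + i) * a i * x ^ i := by
    rw [← tsum_mul_left]
    refine tsum_congr fun i => ?_
    rcases i with _ | i
    · simp
    · simp only [Nat.add_sub_cancel, pow_succ]
      ring
  have h3 : ∑' i : ℕ, (p + i) * a i * x ^ i =
      p * (∑' i : ℕ, a i * x ^ i) + ∑' i : ℕ, (0 + i) * a i * x ^ i := by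
    rw [← tsum_mul_left, ← ((h x hx').mul_left p).tsum_add (h.add_natCast_mul 0 x hx')]
    exact tsum_congr fun i => by ring
  rw [frobeniusSum, h3, ← h2, hp]
  ring

theorem ConvergesOn.deriv_eqOn {ρ : ℝ} {a : ℕ → ℝ} (h : ConvergesOn ρ a) {p r₀ : ℝ}
    {g : ℝ → ℝ} (hg : Set.EqOn g (fun s => frobeniusSum p a (s - r₀)) (Set.Ioo r₀ (r₀ + ρ))) :
    Set.EqOn (deriv g) (fun s => frobeniusSum (p - 1) (fun i => (p + i) * a i) (s - r₀))
      (Set.Ioo r₀ (r₀ + ρ)) := by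
  intro r hr
  rw [(hg.eventuallyEq_of_mem (isOpen_Ioo.mem_nhds hr)).deriv_eq]
  have h1 := h.hasDerivAt_frobeniusSum p (x := r - r₀) (by linarith [hr.1]) (by linarith [hr.2])
  exact (h1.comp_sub_const r r₀).deriv

theorem ConvergesOn.mul {ρ : ℝ} {a b : ℕ → ℝ} (ha : ConvergesOn ρ a) (hb : ConvergesOn ρ b) :
    ConvergesOn ρ (fun n => ∑ x ∈ Finset.HasAntidiagonal.antidiagonal n, a x.1 * b x.2) := by
  intro x hx
  refine (summable_norm_sum_mul_antidiagonal_of_summable_norm (f := fun i => a i * x ^ i)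
    (g := fun i => b i * x ^ i) (ha x hx).abs
    (hb x hx).abs).of_norm.congr fun n => ?_
  rw [Finset.sum_mul]
  refine Finset.sum_congr rfl fun i hi => ?_
  rw [← Finset.HasAntidiagonal.mem_antidiagonal.1 hi, pow_add]
  ring

theorem frobeniusSum_mul {ρ : ℝ} {a b : ℕ → ℝ} (ha : ConvergesOn ρ a) (hb : ConvergesOn ρ b)
    (p q : ℝ) {x : ℝ} (hx0 : 0 < x) (hx : x < ρ) :
    frobeniusSum p a x * frobeniusSum q b x = frobeniusSum (p + q)
      (fun n => ∑ x ∈ Finset.HasAntidiagonal.antidiagonal n, a x.1 * b x.2) x := by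
  have hx' : |x| < ρ := by rwa [abs_of_pos hx0]
  rw [frobeniusSum, frobeniusSum, frobeniusSum, Real.rpow_add hx0, mul_mul_mul_comm,
    tsum_mul_tsum_eq_tsum_sum_antidiagonal_of_summable_norm
      (f := fun i => a i * x ^ i) (g := fun i => b i * x ^ i) (ha x hx').abs (hb x hx').abs]
  congr 1
  refine tsum_congr fun n => ?_
  rw [Finset.sum_mul]
  refine Finset.sum_congr rfl fun i hi => ?_
  rw [← Finset.HasAntidiagonal.mem_antidiagonal.1 hi, pow_add]
  ring

/-- The Hahn series `F` converges absolutely at `x` with sum `y`. -/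
def HasEval (F : HahnSeries ℝ ℝ) (x y : ℝ) : Prop :=
  HasSum (fun e : ℝ => F.coeff e * x ^ e) y

theorem ConvergesOn.hasEval {ρ : ℝ} {a : ℕ → ℝ} (h : ConvergesOn ρ a) (p : ℝ)
    {x : ℝ} (hx0 : 0 < x) (hx : x < ρ) : HasEval (frobeniusSeries p a) x (frobeniusSum p a x) := by
  have hinj : Function.Injective (fun n : ℕ => p + n) := fun m n hmn => by simpa using hmn
  refine (hinj.hasSum_iff fun e he => ?_).1 ?_
  · rw [frobeniusSeries_coeff_of_forall_ne a, zero_mul]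
    rintro n rfl
    exact he ⟨n, rfl⟩
  · have h1 := (h x (by rwa [abs_of_pos hx0])).hasSum.mul_left (x ^ p)
    have h2 : ((fun e => (frobeniusSeries p a).coeff e * x ^ e) ∘ fun n : ℕ => p + n) =
        fun i : ℕ => x ^ p * (a i * x ^ i) := by
      funext n
      simp only [Function.comp_apply, frobeniusSeries_coeff_add, Real.rpow_add hx0,
        Real.rpow_natCast]
      ring
    rw [h2]
    exact h1

/-- A Hahn series that vanishes as a function near `0` vanishes. -/
theorem eq_zero_of_hasEval_zero {F : HahnSeries ℝ ℝ} {ρ : ℝ} (hρ : 0 < ρ)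
    (h : ∀ x, 0 < x → x < ρ → HasEval F x 0) : F = 0 := by
  by_contra hF
  set e₀ := F.order
  obtain ⟨y, hy0, hyρ⟩ := exists_between hρ
  have hs : Summable fun e => |F.coeff e * y ^ (e - e₀)| := by
    refine (((h y hy0 hyρ).summable.mul_right (y ^ (-e₀))).congr fun e => ?_).abs
    rw [sub_eq_add_neg, Real.rpow_add hy0, mul_assoc]
  -- Divide by the leading power and let `x` tend to `0` from the right: dominated by the terms at
  -- `y`, the sum tends to the leading coefficient, while `hzero` shows that it tends to `0`.
  have hlim : Tendsto (fun x => ∑' e, F.coeff e * x ^ (e - e₀)) (𝓝[>] 0)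
      (𝓝 (∑' e, if e = e₀ then F.coeff e₀ else 0)) := by
    refine tendsto_tsum_of_dominated_convergence hs (fun e => ?_) ?_
    · rcases lt_trichotomy e e₀ with he | he | he
      · simp [HahnSeries.coeff_eq_zero_of_lt_order he, he.ne]
      · simp [he]
      · have h1 : Tendsto (fun x : ℝ => x ^ (e - e₀)) (𝓝[>] 0) (𝓝 0) := by
          have := (Real.continuousAt_rpow_const 0 (e - e₀) (Or.inr (by linarith))).tendsto
          rw [Real.zero_rpow (by linarith)] at this
          exact this.mono_left nhdsWithin_le_nhds
        simpa [he.ne'] using h1.const_mul (F.coeff e)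
    · filter_upwards [Ioo_mem_nhdsGT hy0] with x hx e
      rw [Real.norm_eq_abs, abs_mul, abs_mul]
      rcases lt_or_ge e e₀ with he | he
      · simp [HahnSeries.coeff_eq_zero_of_lt_order he]
      · rw [abs_of_pos (Real.rpow_pos_of_pos hx.1 _), abs_of_pos (Real.rpow_pos_of_pos hy0 _)]
        exact mul_le_mul_of_nonneg_left (Real.rpow_le_rpow hx.1.le hx.2.le (by linarith))
          (abs_nonneg _)
  rw [tsum_ite_eq] at hlim
  have hzero : Tendsto (fun x => ∑' e, F.coeff e * x ^ (e - e₀)) (𝓝[>] 0) (𝓝 0) := by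
    refine tendsto_const_nhds.congr' ?_
    filter_upwards [Ioo_mem_nhdsGT hρ] with x hx
    have h1 := ((h x hx.1 hx.2).mul_right (x ^ (-e₀))).tsum_eq
    rw [zero_mul] at h1
    rw [← h1]
    refine tsum_congr fun e => ?_
    rw [sub_eq_add_neg, Real.rpow_add hx.1, mul_assoc]
  exact hF (HahnSeries.coeff_order_eq_zero.1 (tendsto_nhds_unique hlim hzero))

/-- Evaluation commutes with the derivatives and products in the equation, so both directions of the
formal/functional equivalence reduce to the vanishing of one Hahn series. -/
theorem hasEval_formalReducedODE (β γ Λ p r₀ : ℝ) {ρ : ℝ} {a : ℕ → ℝ} (h : ConvergesOn ρ a)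
    {r : ℝ} (hr : r ∈ Set.Ioo r₀ (r₀ + ρ)) :
    HasEval (formalReducedODE β γ Λ (frobeniusSeries p a)) (r - r₀)
      (reducedODE β γ Λ (fun s => frobeniusSum p a (s - r₀)) r) := by
  have hx0 : 0 < r - r₀ := by linarith [hr.1]
  have hx : r - r₀ < ρ := by linarith [hr.2]
  have c1 := h.add_natCast_mul p
  have c2 := c1.add_natCast_mul (p - 1)
  have c3 := c2.add_natCast_mul (p - 1 - 1)
  have c4 := c3.add_natCast_mul (p - 1 - 1 - 1)
  have d1 := h.deriv_eqOn (p := p) (r₀ := r₀) (fun _ _ => rfl)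
  have d2 := c1.deriv_eqOn d1
  have d3 := c2.deriv_eqOn d2
  have d4 := c3.deriv_eqOn d3
  simp only [reducedODE, iteratedDeriv_succ, iteratedDeriv_zero, d1 hr, d2 hr, d3 hr, d4 hr]
  rw [frobeniusSum_mul h c4 _ _ hx0 hx, frobeniusSum_mul c3 c1 _ _ hx0 hx]
  simp only [formalReducedODE, Function.iterate_succ, Function.iterate_zero, Function.comp_apply,
    id, formalDeriv_frobeniusSeries, frobeniusSeries_mul]
  have e2 := c2.hasEval (p - 1 - 1) hx0 hx
  have e4 := (h.mul c4).hasEval (p + (p - 1 - 1 - 1 - 1)) hx0 hx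
  have e31 := (c3.mul c1).hasEval (p - 1 - 1 - 1 + (p - 1)) hx0 hx
  have e0 : HasEval (HahnSeries.C (2 * γ * Λ)) (r - r₀) (2 * γ * Λ) := by
    rw [HasEval, HahnSeries.C_apply]
    convert hasSum_single (0 : ℝ) fun e he => ?_ using 1
    · simp
    · simp [HahnSeries.coeff_single_of_ne he]
  rw [HasEval] at *
  refine Eq.mp (congrArg (HasSum · _) (funext fun e => ?_))
    ((e0.add (e2.mul_left γ)).sub ((e4.add e31).mul_left (6 * β)))
  simp only [HahnSeries.coeff_sub, HahnSeries.coeff_add, HahnSeries.coeff_smul, smul_eq_mul]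
  ring

theorem reducedODE_eq_zero_iff_formal (β γ Λ p r₀ : ℝ) {ρ : ℝ} (hρ : 0 < ρ) {a : ℕ → ℝ}
    (h : ConvergesOn ρ a) :
    (∀ r ∈ Set.Ioo r₀ (r₀ + ρ),
      reducedODE β γ Λ (fun s => frobeniusSum p a (s - r₀)) r = 0) ↔
        formalReducedODE β γ Λ (frobeniusSeries p a) = 0 := by
  refine ⟨fun h0 => eq_zero_of_hasEval_zero hρ fun x hx0 hx => ?_, fun h0 r hr => ?_⟩
  · have hr : r₀ + x ∈ Set.Ioo r₀ (r₀ + ρ) := ⟨by linarith, by linarith⟩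
    have := hasEval_formalReducedODE β γ Λ p r₀ h hr
    rwa [h0 _ hr, add_sub_cancel_left] at this
  · have := hasEval_formalReducedODE β γ Λ p r₀ h hr
    rw [h0] at this
    refine HasSum.unique this ?_
    simp [hasSum_zero]

/-! ### The recursions -/

theorem quadraticCoeff_zero (p : ℝ) (a : ℕ → ℝ) :
    quadraticCoeff p a 0 = (2 * p - 3) * (a 0 ^ 2 * (p * (p - 1) * (p - 2))) := by
  simp only [quadraticCoeff, Finset.Nat.antidiagonal_zero, Finset.sum_singleton]
  push_cast
  ring

/-- The two ends of the antidiagonal, the only places where `a (m + 1)` occurs, are split off; what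
remains involves earlier coefficients only. -/
theorem quadraticCoeff_succ (p : ℝ) (a : ℕ → ℝ) (m : ℕ) :
    quadraticCoeff p a (m + 1) = (2 * p + m - 2) *
      (a 0 * a (m + 1) * (p * (p - 1) * (p - 2) + (p + m + 1) * (p + m) * (p + m - 1)) +
        ∑ j ∈ Finset.Icc 1 m, a j * a (m + 1 - j) * ((p + j) * (p + j - 1) * (p + j - 2))) := by
  have h1 := Finset.Nat.sum_antidiagonal_eq_sum_range_succ
    (fun i j => a j * a i * ((p + i) * (p + i - 1) * (p + i - 2))) (m + 1)
  have h2 : ∑ x ∈ Finset.HasAntidiagonal.antidiagonal (m + 1),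
      a x.1 * a x.2 * (p + x.2) * (p + x.2 - 1) * (p + x.2 - 2) =
      ∑ x ∈ Finset.HasAntidiagonal.antidiagonal (m + 1),
        a x.2 * a x.1 * ((p + x.1) * (p + x.1 - 1) * (p + x.1 - 2)) := by
    rw [← Finset.Nat.sum_antidiagonal_swap]
    exact Finset.sum_congr rfl fun x _ => by simp only [Prod.fst_swap, Prod.snd_swap]; ring
  have h3 : Finset.Icc 1 m = Finset.Ico (0 + 1) (m + 1) := by
    ext; simp
  rw [quadraticCoeff, h2, h1, Finset.sum_range_succ, Finset.sum_range_succ', h3,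
    ← Finset.sum_Ico_add' _ 0 m 1, ← Finset.range_eq_Ico]
  have h4 : ∑ k ∈ Finset.range m, a (m + 1 - (k + 1)) * a (k + 1) *
        ((p + (k + 1 : ℕ)) * (p + (k + 1 : ℕ) - 1) * (p + (k + 1 : ℕ) - 2)) =
      ∑ k ∈ Finset.range m, a (k + 1) * a (m + 1 - (k + 1)) *
        ((p + (k + 1 : ℕ)) * (p + (k + 1 : ℕ) - 1) * (p + (k + 1 : ℕ) - 2)) :=
    Finset.sum_congr rfl fun x _ => by ring
  rw [h4, Nat.sub_zero, Nat.sub_self]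
  push_cast
  ring

theorem formalReducedODE_two_iff (β γ Λ : ℝ) (a : ℕ → ℝ) :
    formalReducedODE β γ Λ (frobeniusSeries 2 a) = 0 ↔ γ * (Λ + a 0) = 0 ∧
      ∀ m : ℕ, (m + 3) * a (m + 1) * (γ - 6 * β * a 0 * (m + 1) * (m + 2)) =
        6 * β * ∑ j ∈ Finset.Icc 1 m,
          a j * a (m + 1 - j) * ((j : ℝ) + 2) * ((j : ℝ) + 1) * (j : ℝ) := by
  have hS : ∀ m : ℕ, quadraticCoeff 2 a (m + 1) = (m + 2) *
      (a 0 * a (m + 1) * ((m + 3) * (m + 2) * (m + 1)) + ∑ j ∈ Finset.Icc 1 m,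
        a j * a (m + 1 - j) * ((j : ℝ) + 2) * ((j : ℝ) + 1) * (j : ℝ)) := fun m => by
    rw [quadraticCoeff_succ, Finset.sum_congr rfl fun j _ => show
      a j * a (m + 1 - j) * ((2 + (j : ℝ)) * (2 + j - 1) * (2 + j - 2)) =
        a j * a (m + 1 - j) * ((j : ℝ) + 2) * ((j : ℝ) + 1) * (j : ℝ) by ring]
    ring
  rw [formalReducedODE_eq_zero_iff 0 (by simp)]
  refine ⟨fun h => ⟨?_, fun m => ?_⟩, fun ⟨h0, h⟩ n => ?_⟩
  · have := h 0
    simp [quadraticCoeff_zero] at this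
    linarith
  · have := h (m + 1)
    simp [hS] at this
    -- This common factor comes from the outer derivative: `2γΛ + γ f''` is a derivative as well.
    have hm : (m : ℝ) + 2 ≠ 0 := by positivity
    apply mul_left_cancel₀ hm
    linear_combination this
  · rcases n with _ | m
    · simp [quadraticCoeff_zero]
      linear_combination 2 * h0
    · simp [hS]
      linear_combination ((m : ℝ) + 2) * h m

theorem formalReducedODE_one_iff (β γ Λ : ℝ) (a : ℕ → ℝ) :
    formalReducedODE β γ Λ (frobeniusSeries 1 a) = 0 ↔
      γ * (a 1 + Λ) = 18 * β * a 0 * a 2 ∧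
      ∀ l : ℕ, 1 ≤ l → γ * a (l + 1) * (l + 2) =
        6 * β * a 0 * (l + 3) * (l + 2) * (l + 1) * a (l + 2) +
        6 * β * ∑ j ∈ Finset.Icc 1 (l + 1),
          a j * a (l + 2 - j) * (j : ℝ) * ((j : ℝ) + 1) * ((j : ℝ) - 1) := by
  have hS : ∀ l : ℕ, quadraticCoeff 1 a (l + 2) = (l + 1) *
      (a 0 * a (l + 2) * ((l + 3) * (l + 2) * (l + 1)) + ∑ j ∈ Finset.Icc 1 (l + 1),
        a j * a (l + 2 - j) * (j : ℝ) * ((j : ℝ) + 1) * ((j : ℝ) - 1)) := fun l => by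
    rw [quadraticCoeff_succ, Finset.sum_congr rfl fun j _ => show
      a j * a (l + 1 + 1 - j) * ((1 + (j : ℝ)) * (1 + j - 1) * (1 + j - 2)) =
        a j * a (l + 2 - j) * (j : ℝ) * ((j : ℝ) + 1) * ((j : ℝ) - 1) by ring]
    push_cast
    ring
  rw [formalReducedODE_eq_zero_iff 1 (by norm_num)]
  refine ⟨fun h => ⟨?_, fun l hl => ?_⟩, fun ⟨h0, h⟩ n => ?_⟩
  · have := h 2
    simp [quadraticCoeff_succ] at this
    linear_combination this / 2
  · have := h (l + 2)
    simp [hS, show l ≠ 0 by omega] at this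
    have hm : (l : ℝ) + 1 ≠ 0 := by positivity
    apply mul_left_cancel₀ hm
    linear_combination this
  -- The two lowest coefficients vanish identically, which leaves `a 1` free; `Λ` enters only at `n
  -- = 2`.
  · rcases n with _ | _ | _ | l
    · simp [quadraticCoeff_zero]
    · simp [quadraticCoeff_succ]
    · simp [quadraticCoeff_succ]
      linear_combination 2 * h0
    · have := h (l + 1) (by omega)
      push_cast at this
      simp [hS (l + 1)]
      linear_combination ((l : ℝ) + 2) * this

theorem formalReducedODE_zero_iff (β γ Λ : ℝ) (a : ℕ → ℝ) :
    formalReducedODE β γ Λ (frobeniusSeries 0 a) = 0 ↔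
      γ * (a 2 + Λ) = 72 * β * a 0 * a 4 + 18 * β * a 1 * a 3 ∧
      ∀ l : ℕ, 1 ≤ l → γ * a (l + 2) * (l + 2) =
        6 * β * a 0 * (l + 4) * (l + 3) * (l + 2) * a (l + 4) +
        6 * β * ∑ j ∈ Finset.Icc 1 (l + 3),
          a j * a (l + 4 - j) * (j : ℝ) * ((j : ℝ) - 1) * ((j : ℝ) - 2) := by
  have hS : ∀ m : ℕ, ∑ j ∈ Finset.Icc 1 m,
      a j * a (m + 1 - j) * ((j : ℝ) * (j - 1) * (j - 2)) =
      ∑ j ∈ Finset.Icc 1 m, a j * a (m + 1 - j) * (j : ℝ) * ((j : ℝ) - 1) * ((j : ℝ) - 2) :=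
    fun m => Finset.sum_congr rfl fun j _ => by ring
  rw [formalReducedODE_eq_zero_iff 2 (by norm_num)]
  refine ⟨fun h => ⟨?_, fun l hl => ?_⟩, fun ⟨h0, h⟩ n => ?_⟩
  · have := h 4
    simp [quadraticCoeff_succ, Finset.sum_Icc_succ_top] at this
    linear_combination this / 2
  · have := h (l + 4)
    simp [quadraticCoeff_succ, hS, show l ≠ 0 by omega] at this
    have hm : (l : ℝ) + 1 ≠ 0 := by positivity
    apply mul_left_cancel₀ hm
    linear_combination this
  -- Below `n = 3` third derivatives kill every term; at `n = 3` the factor `2p + n - 3` is zero,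
  -- which leaves `a 3` free.
  · rcases n with _ | _ | _ | _ | _ | l
    · simp [quadraticCoeff_zero]
    · simp [quadraticCoeff_succ]
    · simp [quadraticCoeff_succ]
    · simp [quadraticCoeff_succ]
    · simp [quadraticCoeff_succ, Finset.sum_Icc_succ_top]
      linear_combination 2 * h0
    · have := h (l + 1) (by omega)
      push_cast at this
      simp [quadraticCoeff_succ, hS]
      linear_combination ((l : ℝ) + 2) * this

theorem existsUnique_recursion (G : ℕ → (ℕ → ℝ) → ℝ)
    (hG : ∀ n a b, (∀ m < n, a m = b m) → G n a = G n b) : ∃! a : ℕ → ℝ, ∀ n, a n = G n a := by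
  let a : ℕ → ℝ := fun n => Nat.strongRec (motive := fun _ => ℝ)
    -- The filler `0` is harmless: by `hG`, `G n` sees only indices below `n`.
    (fun n ih => G n (fun m => if h : m < n then ih m h else 0)) n
  have ha : ∀ n, a n = G n a := fun n => by
    simp only [a]
    rw [Nat.strongRec_eq]
    refine hG n _ _ fun m hm => ?_
    simp [hm]
  refine ⟨a, ha, fun b hb => ?_⟩
  funext n
  induction n using Nat.strong_induction_on with
  | _ n ih => rw [hb, ha, hG n b a ih]

/-! ### Exponents -/

theorem formalReducedODE_gamma_zero_iff (β Λ p : ℝ) (a : ℕ → ℝ) :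
    formalReducedODE β 0 Λ (frobeniusSeries p a) = 0 ↔
      ∀ n, β * quadraticCoeff p a n = 0 := by
  have h : frobeniusSeries (p - 2) (fun i => (0 : ℝ) * ((p - 1 + i) * ((p + i) * a i))) = 0 :=
    frobeniusSeries_eq_zero_iff.2 fun n => by simp
  rw [formalReducedODE_frobeniusSeries, h]
  simp only [mul_zero, zero_mul, map_zero, add_zero, zero_sub, neg_eq_zero,
    frobeniusSeries_eq_zero_iff, mul_assoc]
  simp

theorem IsFrobeniusSolution.exponent {β γ Λ p : ℝ} {a : ℕ → ℝ} (hβγ : β ≠ 0 ∨ γ ≠ 0)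
    (h : IsFrobeniusSolution β γ Λ p a) : p = 0 ∨ p = 1 ∨ p = 3 / 2 ∨ p = 2 := by
  obtain ⟨ha, h⟩ := h
  by_contra! hp
  obtain ⟨hp0, hp1, hp3, hp2⟩ := hp
  have h01 : (p - 1) * (p * a 0) ≠ 0 := mul_ne_zero (sub_ne_zero.2 hp1) (mul_ne_zero hp0 ha)
  have hq : quadraticCoeff p a 0 ≠ 0 := by
    rw [quadraticCoeff_zero]
    have : 2 * p - 3 ≠ 0 := fun h => hp3 (by linarith)
    have := sub_ne_zero.2 hp1
    have := sub_ne_zero.2 hp2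
    positivity
  -- Read off exponent `p - 2`: the quadratic block is absent there, being zero or starting higher.
  have hγ : (β = 0 ∨ 2 < p) → γ = 0 := fun hc => by
    have h1 := congrArg (fun F : HahnSeries ℝ ℝ => F.coeff (p - 2)) h
    have h2 : (frobeniusSeries (2 * p - 4) (fun n => 6 * β * quadraticCoeff p a n)).coeff
        (p - 2) = 0 := by
      rcases hc with rfl | hc
      · rw [frobeniusSeries_eq_zero_iff.2 fun n => by simp]
        rfl
      · exact frobeniusSeries_coeff_of_forall_ne _ fun n hn => by
          have : (0 : ℝ) ≤ n := n.cast_nonneg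
          linarith
    have h3 := frobeniusSeries_coeff_add (p - 2)
      (fun i => γ * ((p - 1 + i) * ((p + i) * a i))) 0
    simp only [formalReducedODE_frobeniusSeries, HahnSeries.coeff_sub, HahnSeries.coeff_add, h2,
      HahnSeries.C_apply, HahnSeries.coeff_single_of_ne (sub_ne_zero.2 hp2)] at h1
    simp only [Nat.cast_zero, add_zero] at h3
    rw [h3] at h1
    simpa [h01] using h1
  by_cases hβ : β = 0
  · exact (hβγ.resolve_left (not_not.2 hβ)) (hγ (Or.inl hβ))
  rcases lt_or_gt_of_ne hp2 with hlt | hgt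
  · have h1 := congrArg (fun F : HahnSeries ℝ ℝ => F.coeff (2 * p - 4)) h
    have h2 : (frobeniusSeries (p - 2) (fun i => γ * ((p - 1 + i) * ((p + i) * a i)))).coeff
        (2 * p - 4) = 0 :=
      frobeniusSeries_coeff_of_forall_ne _ fun n hn => by
        have : (0 : ℝ) ≤ n := n.cast_nonneg
        linarith
    have h3 := frobeniusSeries_coeff_add (2 * p - 4) (fun n => 6 * β * quadraticCoeff p a n) 0
    have h4 : 2 * p - 4 ≠ 0 := fun h => hp2 (by linarith)
    simp only [formalReducedODE_frobeniusSeries, HahnSeries.coeff_sub, HahnSeries.coeff_add, h2,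
      HahnSeries.C_apply, HahnSeries.coeff_single_of_ne h4] at h1
    simp only [Nat.cast_zero, add_zero] at h3
    rw [h3] at h1
    simp [hβ, hq] at h1
  · rw [hγ (Or.inr hgt), formalReducedODE_gamma_zero_iff] at h
    exact mul_ne_zero hβ hq (h 0)

theorem isFrobeniusSolution_three_halves_iff {β γ : ℝ} (Λ : ℝ) (hβγ : β ≠ 0 ∨ γ ≠ 0)
    (a : ℕ → ℝ) : IsFrobeniusSolution β γ Λ (3 / 2) a ↔
      a 0 ≠ 0 ∧ γ = 0 ∧ ∀ i, 1 ≤ i → a i = 0 := by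
  refine ⟨fun ⟨ha, h⟩ => ?_, ?_⟩
  · have hγ : γ = 0 := by
      -- The exponent `-1/2` is not an integer, whereas the quadratic block and the constant have
      -- integer exponents.
      have h1 := congrArg (fun F : HahnSeries ℝ ℝ => F.coeff (3 / 2 - 2)) h
      have h2 : (frobeniusSeries (2 * (3 / 2) - 4)
          (fun n => 6 * β * quadraticCoeff (3 / 2) a n)).coeff (3 / 2 - 2) = 0 :=
        frobeniusSeries_coeff_of_forall_ne _ fun n hn => by
          have h5 : ((2 * n : ℕ) : ℝ) = (1 : ℕ) := by push_cast; linarith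
          have := Nat.cast_injective h5
          omega
      have h3 := frobeniusSeries_coeff_add (3 / 2 - 2)
        (fun i => γ * ((3 / 2 - 1 + i) * ((3 / 2 + i) * a i))) 0
      have h4 : (3 / 2 - 2 : ℝ) ≠ 0 := by norm_num
      simp only [formalReducedODE_frobeniusSeries, HahnSeries.coeff_sub, HahnSeries.coeff_add, h2,
        HahnSeries.C_apply, HahnSeries.coeff_single_of_ne h4] at h1
      simp only [Nat.cast_zero, add_zero] at h3
      rw [h3] at h1
      norm_num [ha] at h1
      exact h1
    subst hγ
    have hβ : β ≠ 0 := hβγ.resolve_right (not_not.2 rfl)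
    rw [formalReducedODE_gamma_zero_iff] at h
    refine ⟨ha, rfl, fun i => ?_⟩
    induction i using Nat.strong_induction_on with
    | _ i ih =>
      intro hi
      obtain ⟨m, rfl⟩ : ∃ m, i = m + 1 := ⟨i - 1, by omega⟩
      have h1 := (mul_eq_zero.1 (h (m + 1))).resolve_left hβ
      rw [quadraticCoeff_succ, Finset.sum_eq_zero] at h1
      · have h2 : (2 * (3 / 2) + m - 2 : ℝ) ≠ 0 := by
          have : (0 : ℝ) ≤ m := m.cast_nonneg
          linarith
        have h3 := (mul_eq_zero.1 h1).resolve_left h2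
        rw [add_zero] at h3
        have h4 : (3 / 2 * (3 / 2 - 1) * (3 / 2 - 2) +
            (3 / 2 + m + 1) * (3 / 2 + m) * (3 / 2 + m - 1) : ℝ) ≠ 0 := by
          have : (0 : ℝ) ≤ m := m.cast_nonneg
          have : (0 : ℝ) < 3 / 2 * (3 / 2 - 1) * (3 / 2 - 2) +
            (3 / 2 + m + 1) * (3 / 2 + m) * (3 / 2 + m - 1) := by
            ring_nf
            positivity
          exact this.ne'
        exact (mul_eq_zero.1 ((mul_eq_zero.1 h3).resolve_right h4)).resolve_left ha
      · intro j hj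
        rw [Finset.mem_Icc] at hj
        rw [ih j (by omega) hj.1]
        ring
  · rintro ⟨ha, rfl, h⟩
    refine ⟨ha, (formalReducedODE_gamma_zero_iff _ _ _ _).2 fun n => ?_⟩
    rcases n with _ | m
    · rw [quadraticCoeff_zero]
      ring
    · rw [quadraticCoeff_succ, Finset.sum_eq_zero, h (m + 1) (by omega)]
      · ring
      · intro j hj
        rw [h j (Finset.mem_Icc.1 hj).1]
        ring

/-! ### Exponent `1` -/

theorem isFrobeniusSolution_one_iff {β : ℝ} (γ Λ : ℝ) (hβ : β ≠ 0) (a : ℕ → ℝ) :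
    IsFrobeniusSolution β γ Λ 1 a ↔
        a 0 ≠ 0 ∧ a 2 = γ * (a 1 + Λ) / (18 * β * a 0) ∧
        ∀ l : ℕ, 1 ≤ l →
          a (l + 2) = (γ * a (l + 1) * ((l : ℝ) + 2) -
              6 * β * ∑ j ∈ Finset.Icc 1 (l + 1),
                a j * a (l + 2 - j) * (j : ℝ) * ((j : ℝ) + 1) * ((j : ℝ) - 1)) /
            (6 * β * a 0 * ((l : ℝ) + 3) * ((l : ℝ) + 2) * ((l : ℝ) + 1)) := by
  rw [IsFrobeniusSolution, formalReducedODE_one_iff]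
  refine and_congr_right fun ha => and_congr ?_ (forall₂_congr fun l _ => ?_)
  · rw [eq_div_iff (by positivity)]
    constructor <;> intro h <;> linear_combination -h
  · rw [eq_div_iff (by positivity)]
    constructor <;> intro h <;> linear_combination -h

theorem existsUnique_isFrobeniusSolution_one {β : ℝ} (γ Λ : ℝ) (hβ : β ≠ 0) {c₀ : ℝ} (c₁ : ℝ)
    (hc : c₀ ≠ 0) : ∃! a : ℕ → ℝ, IsFrobeniusSolution β γ Λ 1 a ∧ a 0 = c₀ ∧ a 1 = c₁ := by
  -- The last branch is the recursion at index `l + 1`, since the rule starts at index `1`; the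
  -- spelling makes it match definitionally.
  let G : ℕ → (ℕ → ℝ) → ℝ := fun n a => match n with
    | 0 => c₀
    | 1 => c₁
    | 2 => γ * (a 1 + Λ) / (18 * β * a 0)
    | l + 3 => (γ * a (l + 1 + 1) * (((l + 1 : ℕ) : ℝ) + 2) -
        6 * β * ∑ j ∈ Finset.Icc 1 (l + 1 + 1),
          a j * a (l + 1 + 2 - j) * (j : ℝ) * ((j : ℝ) + 1) * ((j : ℝ) - 1)) /
            (6 * β * a 0 * (((l + 1 : ℕ) : ℝ) + 3) * (((l + 1 : ℕ) : ℝ) + 2) *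
              (((l + 1 : ℕ) : ℝ) + 1))
  refine (existsUnique_congr fun a => ?_).1 (existsUnique_recursion G ?_)
  · rw [isFrobeniusSolution_one_iff γ Λ hβ]
    constructor
    · intro h
      refine ⟨⟨?_, h 2, fun l hl => ?_⟩, h 0, h 1⟩
      · rw [h 0]; exact hc
      · obtain ⟨m, rfl⟩ : ∃ m, l = m + 1 := ⟨l - 1, by omega⟩
        exact h (m + 3)
    · rintro ⟨⟨-, h2, h⟩, h0, h1⟩ (_ | _ | _ | l)
      exacts [h0, h1, h2, h (l + 1) (by omega)]
  · rintro (_ | _ | _ | l) a b hab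
    · rfl
    · rfl
    · simp only [G]
      rw [hab 0 (by omega), hab 1 (by omega)]
    · simp only [G]
      rw [hab 0 (by omega), hab (l + 1 + 1) (by omega)]
      congr 3
      refine Finset.sum_congr rfl fun j hj => ?_
      rw [Finset.mem_Icc] at hj
      rw [hab j (by omega), hab (l + 1 + 2 - j) (by omega)]

theorem IsFrobeniusSolution.coeff_three_of_one {β γ Λ : ℝ} (hβ : β ≠ 0) {a : ℕ → ℝ}
    (h : IsFrobeniusSolution β γ Λ 1 a) :
    a 3 = -(γ * (a 1 + Λ) * (12 * β * a 1 - γ) / (864 * β ^ 2 * a 0 ^ 2)) := by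
  obtain ⟨ha, h2, h⟩ := (isFrobeniusSolution_one_iff γ Λ hβ a).1 h
  have h3 := h 1 le_rfl
  simp [Finset.sum_Icc_succ_top] at h3
  rw [h3, h2]
  field_simp
  ring

theorem IsFrobeniusSolution.coeff_four_of_one {β γ Λ : ℝ} (hβ : β ≠ 0) {a : ℕ → ℝ}
    (h : IsFrobeniusSolution β γ Λ 1 a) :
    a 4 = γ * (a 1 + Λ) *
        (432 * β ^ 2 * a 1 ^ 2 - 72 * β * γ * a 1 + γ ^ 2 - 24 * β * γ * Λ) /
      (77760 * β ^ 3 * a 0 ^ 3) := by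
  have h3 := h.coeff_three_of_one hβ
  obtain ⟨ha, h2, h⟩ := (isFrobeniusSolution_one_iff γ Λ hβ a).1 h
  have h4 := h 2 (by norm_num)
  simp [Finset.sum_Icc_succ_top] at h4
  rw [h4, h3, h2]
  field_simp
  ring

/-- Once `a 2` vanishes, every product in the recursion contains a vanishing coefficient, except at
`j = 1`, where the factor `j - 1` is zero. -/
theorem IsFrobeniusSolution.eq_zero_of_one {β γ Λ : ℝ} (hβ : β ≠ 0) {a : ℕ → ℝ}
    (h : IsFrobeniusSolution β γ Λ 1 a) (h1 : a 1 = -Λ ∨ γ = 0) (i : ℕ) (hi : 2 ≤ i) :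
    a i = 0 := by
  obtain ⟨ha, h2, h⟩ := (isFrobeniusSolution_one_iff γ Λ hβ a).1 h
  have h2' : a 2 = 0 := by
    rw [h2]
    rcases h1 with h1 | h1 <;> simp [h1]
  induction i using Nat.strong_induction_on with
  | _ i ih =>
    rcases hi.eq_or_lt with rfl | hi'
    · exact h2'
    obtain ⟨l, rfl⟩ : ∃ l, i = l + 2 := ⟨i - 2, by omega⟩
    rw [h l (by omega), ih (l + 1) (by omega) (by omega), Finset.sum_eq_zero]
    · simp
    · intro j hj
      rw [Finset.mem_Icc] at hj
      rcases hj.1.eq_or_lt with rfl | hj'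
      · simp
      · rw [ih j (by omega) hj']
        ring

/-! ### Exponent `0` -/

theorem isFrobeniusSolution_zero_iff {β : ℝ} (γ Λ : ℝ) (hβ : β ≠ 0) (a : ℕ → ℝ) :
    IsFrobeniusSolution β γ Λ 0 a ↔
        a 0 ≠ 0 ∧ a 4 = -(a 1 * a 3 / (4 * a 0)) + γ * (a 2 + Λ) / (72 * β * a 0) ∧
        ∀ l : ℕ, 1 ≤ l →
          a (l + 4) = (γ * a (l + 2) * ((l : ℝ) + 2) -
              6 * β * ∑ j ∈ Finset.Icc 1 (l + 3),
                a j * a (l + 4 - j) * (j : ℝ) * ((j : ℝ) - 1) * ((j : ℝ) - 2)) /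
            (6 * β * a 0 * ((l : ℝ) + 4) * ((l : ℝ) + 3) * ((l : ℝ) + 2)) := by
  rw [IsFrobeniusSolution, formalReducedODE_zero_iff]
  refine and_congr_right fun ha => and_congr ?_ (forall₂_congr fun l _ => ?_)
  · have h4 : -(a 1 * a 3 / (4 * a 0)) + γ * (a 2 + Λ) / (72 * β * a 0) =
        (γ * (a 2 + Λ) - 18 * β * a 1 * a 3) / (72 * β * a 0) := by
      field_simp
      ring
    rw [h4, eq_div_iff (by positivity)]
    constructor <;> intro h <;> linear_combination -h
  · rw [eq_div_iff (by positivity)]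
    constructor <;> intro h <;> linear_combination -h

theorem existsUnique_isFrobeniusSolution_zero {β : ℝ} (γ Λ : ℝ) (hβ : β ≠ 0) {c₀ : ℝ}
    (c₁ c₂ c₃ : ℝ) (hc : c₀ ≠ 0) : ∃! a : ℕ → ℝ, IsFrobeniusSolution β γ Λ 0 a ∧
      a 0 = c₀ ∧ a 1 = c₁ ∧ a 2 = c₂ ∧ a 3 = c₃ := by
  let G : ℕ → (ℕ → ℝ) → ℝ := fun n a => match n with
    | 0 => c₀
    | 1 => c₁
    | 2 => c₂
    | 3 => c₃
    | 4 => -(a 1 * a 3 / (4 * a 0)) + γ * (a 2 + Λ) / (72 * β * a 0)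
    | l + 5 => (γ * a (l + 1 + 2) * (((l + 1 : ℕ) : ℝ) + 2) -
        6 * β * ∑ j ∈ Finset.Icc 1 (l + 1 + 3),
          a j * a (l + 1 + 4 - j) * (j : ℝ) * ((j : ℝ) - 1) * ((j : ℝ) - 2)) /
            (6 * β * a 0 * (((l + 1 : ℕ) : ℝ) + 4) * (((l + 1 : ℕ) : ℝ) + 3) *
              (((l + 1 : ℕ) : ℝ) + 2))
  refine (existsUnique_congr fun a => ?_).1 (existsUnique_recursion G ?_)
  · rw [isFrobeniusSolution_zero_iff γ Λ hβ]
    constructor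
    · intro h
      refine ⟨⟨?_, h 4, fun l hl => ?_⟩, h 0, h 1, h 2, h 3⟩
      · rw [h 0]; exact hc
      · obtain ⟨m, rfl⟩ : ∃ m, l = m + 1 := ⟨l - 1, by omega⟩
        exact h (m + 5)
    · rintro ⟨⟨-, h4, h⟩, h0, h1, h2, h3⟩ (_ | _ | _ | _ | _ | l)
      exacts [h0, h1, h2, h3, h4, h (l + 1) (by omega)]
  · rintro (_ | _ | _ | _ | _ | l) a b hab
    · rfl
    · rfl
    · rfl
    · rfl
    · simp only [G]
      rw [hab 0 (by omega), hab 1 (by omega), hab 2 (by omega), hab 3 (by omega)]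
    · simp only [G]
      rw [hab 0 (by omega), hab (l + 1 + 2) (by omega)]
      congr 3
      refine Finset.sum_congr rfl fun j hj => ?_
      rw [Finset.mem_Icc] at hj
      rw [hab j (by omega), hab (l + 1 + 4 - j) (by omega)]

theorem IsFrobeniusSolution.coeff_five_of_zero {β γ Λ : ℝ} (hβ : β ≠ 0) {a : ℕ → ℝ}
    (h : IsFrobeniusSolution β γ Λ 0 a) :
    a 5 = -(a 3 * (a 0 * a 2 - a 1 ^ 2) / (10 * a 0 ^ 2)) +
      γ * (3 * a 0 * a 3 - 2 * a 1 * (a 2 + Λ)) / (360 * β * a 0 ^ 2) := by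
  obtain ⟨ha, h4, h⟩ := (isFrobeniusSolution_zero_iff γ Λ hβ a).1 h
  have h5 := h 1 le_rfl
  simp [Finset.sum_Icc_succ_top] at h5
  rw [h5, h4]
  field_simp
  ring

theorem IsFrobeniusSolution.coeff_six_of_zero {β γ Λ : ℝ} (hβ : β ≠ 0) {a : ℕ → ℝ}
    (h : IsFrobeniusSolution β γ Λ 0 a) :
    a 6 = -(a 3 ^ 2 / (20 * a 0)) +
      a 1 * a 3 * (9 * β * (2 * a 0 * a 2 - a 1 ^ 2) - γ * a 0) / (180 * β * a 0 ^ 3) -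
      γ * (a 2 + Λ) * (36 * β * (a 0 * a 2 - a 1 ^ 2) - γ * a 0) /
        (12960 * β ^ 2 * a 0 ^ 3) := by
  have h5 := h.coeff_five_of_zero hβ
  obtain ⟨ha, h4, h⟩ := (isFrobeniusSolution_zero_iff γ Λ hβ a).1 h
  have h6 := h 2 (by norm_num)
  simp [Finset.sum_Icc_succ_top] at h6
  rw [h6, h5, h4]
  field_simp
  ring

theorem IsFrobeniusSolution.eq_zero_of_zero {β γ Λ : ℝ} (hβ : β ≠ 0) {a : ℕ → ℝ}
    (h : IsFrobeniusSolution β γ Λ 0 a) (h3 : a 3 = 0) (h2 : a 2 = -Λ ∨ γ = 0) (i : ℕ)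
    (hi : 3 ≤ i) : a i = 0 := by
  obtain ⟨ha, h4, h⟩ := (isFrobeniusSolution_zero_iff γ Λ hβ a).1 h
  have h4' : a 4 = 0 := by
    rw [h4, h3]
    rcases h2 with h2 | h2 <;> simp [h2]
  induction i using Nat.strong_induction_on with
  | _ i ih =>
    rcases hi.eq_or_lt with rfl | hi'
    · exact h3
    rcases (show 4 ≤ i from hi').eq_or_lt with rfl | hi''
    · exact h4'
    obtain ⟨l, rfl⟩ : ∃ l, i = l + 4 := ⟨i - 4, by omega⟩
    rw [h l (by omega), ih (l + 2) (by omega) (by omega), Finset.sum_eq_zero]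
    · simp
    · intro j hj
      rw [Finset.mem_Icc] at hj
      rcases hj.1.eq_or_lt with rfl | hj'
      · simp
      -- The possibly nonzero `a 1` and `a 2` do no harm: `(j - 1) (j - 2)` vanishes at `j = 1, 2`.
      rcases (show 2 ≤ j from hj').eq_or_lt with rfl | hj''
      · simp
      · rw [ih j (by omega) hj'']
        ring

/-! ### Exponent `2` -/

/-- Displays the unique zero at `l = L` and, for `l > L`, the sign opposite to `γ`. -/
theorem resonance_bracket {β γ Λ : ℝ} (hβ : β ≠ 0) {L : ℕ} (hL : 1 ≤ L)
    (hΛ : Λ = -γ / (6 * β * L * (L + 1))) (l : ℕ) :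
    γ + 6 * β * Λ * l * (l + 1) = γ * ((L : ℝ) * (L + 1) - l * (l + 1)) / (L * (L + 1)) := by
  have hL' : (L : ℝ) ≠ 0 := by positivity
  rw [hΛ]
  field_simp
  ring

theorem resonance_bracket_ne_zero {β γ Λ : ℝ} (hβ : β ≠ 0) (hγ : γ ≠ 0) {L : ℕ} (hL : 1 ≤ L)
    (hΛ : Λ = -γ / (6 * β * L * (L + 1))) {l : ℕ} (hl : l ≠ L) :
    γ + 6 * β * Λ * l * (l + 1) ≠ 0 := by
  have hL' : (L : ℝ) ≠ 0 := by positivity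
  have h1 : (L : ℝ) * (L + 1) - l * (l + 1) ≠ 0 := by
    have h2 : (L : ℝ) * (L + 1) - l * (l + 1) = (L - l) * (L + l + 1) := by ring
    have h3 : (L : ℝ) - l ≠ 0 := sub_ne_zero.2 (Nat.cast_injective.ne hl.symm)
    rw [h2]
    positivity
  rw [resonance_bracket hβ hL hΛ]
  positivity

/-- Left undivided because the bracket may vanish. -/
theorem isFrobeniusSolution_two_iff_recursion (β Λ : ℝ) {γ : ℝ} (hγ : γ ≠ 0) (a : ℕ → ℝ) :
    IsFrobeniusSolution β γ Λ 2 a ↔ a 0 ≠ 0 ∧ a 0 = -Λ ∧ ∀ l : ℕ, 1 ≤ l →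
      a l * ((l + 2) * (γ + 6 * β * Λ * l * (l + 1))) = 6 * β * ∑ j ∈ Finset.Icc 1 (l - 1),
        a j * a (l - j) * ((j : ℝ) + 2) * ((j : ℝ) + 1) * (j : ℝ) := by
  rw [IsFrobeniusSolution, formalReducedODE_two_iff]
  have h0 : γ * (Λ + a 0) = 0 ↔ a 0 = -Λ := by
    rw [mul_eq_zero, or_iff_right hγ]
    constructor <;> intro h <;> linarith
  rw [h0]
  refine and_congr_right fun ha => and_congr_right fun hΛ => ⟨fun h l hl => ?_, fun h m => ?_⟩
  · obtain ⟨m, rfl⟩ : ∃ m, l = m + 1 := ⟨l - 1, by omega⟩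
    rw [Nat.add_sub_cancel, ← h m, hΛ]
    push_cast
    ring
  · have := h (m + 1) (by omega)
    rw [Nat.add_sub_cancel] at this
    rw [← this, hΛ]
    push_cast
    ring

theorem isFrobeniusSolution_two_iff_of_resonance {β γ Λ : ℝ} (hβ : β ≠ 0) (hγ : γ ≠ 0) {L : ℕ}
    (hL : 1 ≤ L) (hΛ : Λ = -γ / (6 * β * L * (L + 1))) (a : ℕ → ℝ) :
    IsFrobeniusSolution β γ Λ 2 a ↔ a 0 = -Λ ∧ (∀ i, 1 ≤ i → i < L → a i = 0) ∧
      ∀ l : ℕ, L < l →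
        a l = 6 * β * (∑ j ∈ Finset.Icc 1 (l - 1),
            a j * a (l - j) * ((j : ℝ) + 2) * ((j : ℝ) + 1) * (j : ℝ)) /
          (((l : ℝ) + 2) * (γ + 6 * β * Λ * l * (l + 1))) := by
  have hL' : (L : ℝ) ≠ 0 := by positivity
  have hΛ0 : Λ ≠ 0 := by
    rw [hΛ]
    exact div_ne_zero (neg_ne_zero.2 hγ) (by positivity)
  have hd : ∀ l : ℕ, l ≠ L → ((l : ℝ) + 2) * (γ + 6 * β * Λ * l * (l + 1)) ≠ 0 := fun l hl =>
    mul_ne_zero (by positivity) (resonance_bracket_ne_zero hβ hγ hL hΛ hl)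
  rw [isFrobeniusSolution_two_iff_recursion β Λ hγ]
  constructor
  · rintro ⟨-, h0, h⟩
    refine ⟨h0, fun i => ?_, fun l hl => ?_⟩
    · induction i using Nat.strong_induction_on with
      | _ i ih =>
        intro hi hiL
        have h1 := h i hi
        rw [Finset.sum_eq_zero, mul_zero] at h1
        · exact (mul_eq_zero.1 h1).resolve_right (hd i hiL.ne)
        · intro j hj
          rw [Finset.mem_Icc] at hj
          rw [ih j (by omega) hj.1 (by omega)]
          ring
    · rw [eq_div_iff (hd l hl.ne')]
      exact h l (by omega)
  · rintro ⟨h0, hlt, hgt⟩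
    refine ⟨by rw [h0]; exact neg_ne_zero.2 hΛ0, h0, fun l hl => ?_⟩
    rcases lt_or_ge L l with hLl | hLl
    · exact (eq_div_iff (hd l hLl.ne')).1 (hgt l hLl)
    · rw [Finset.sum_eq_zero, mul_zero]
      -- At `l = L` bracket and sum both vanish, so `a L` is unconstrained.
      · rcases hLl.eq_or_lt with rfl | hLl
        · rw [resonance_bracket hβ hL hΛ]
          simp
        · rw [hlt l hl hLl, zero_mul]
      · intro j hj
        rw [Finset.mem_Icc] at hj
        rw [hlt j hj.1 (by omega)]
        ring

theorem isFrobeniusSolution_two_iff {β γ : ℝ} (Λ : ℝ) (hβ : β ≠ 0) (hγ : γ ≠ 0) (a : ℕ → ℝ) :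
    IsFrobeniusSolution β γ Λ 2 a ↔
        a 0 ≠ 0 ∧ a 0 = -Λ ∧
        ((∀ i, 1 ≤ i → a i = 0) ∨
          ∃ L : ℕ, 1 ≤ L ∧ Λ = -γ / (6 * β * L * (L + 1)) ∧
            (∀ i, 1 ≤ i → i < L → a i = 0) ∧
            ∀ l : ℕ, L < l →
              a l = 6 * β * (∑ j ∈ Finset.Icc 1 (l - 1),
                  a j * a (l - j) * ((j : ℝ) + 2) * ((j : ℝ) + 1) * (j : ℝ)) /
                (((l : ℝ) + 2) * (γ + 6 * β * Λ * l * (l + 1)))) := by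
  constructor
  · intro hsol
    obtain ⟨ha, h0, h⟩ := (isFrobeniusSolution_two_iff_recursion β Λ hγ a).1 hsol
    refine ⟨ha, h0, or_iff_not_imp_left.2 fun hne => ?_⟩
    push Not at hne
    classical
    obtain ⟨hL, haL⟩ := Nat.find_spec hne
    set L := Nat.find hne
    have hmin : ∀ i, 1 ≤ i → i < L → a i = 0 := fun i hi hiL => by
      by_contra hai
      exact Nat.find_min hne hiL ⟨hi, hai⟩
    -- At the first nonzero index the convolution sum is empty of nonzero terms, so the bracket must
    -- vanish.
    have hΛ : Λ = -γ / (6 * β * L * (L + 1)) := by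
      have h1 := h L hL
      rw [Finset.sum_eq_zero, mul_zero] at h1
      · have h2 := (mul_eq_zero.1 ((mul_eq_zero.1 h1).resolve_left haL)).resolve_left
          (by positivity)
        have hL' : (L : ℝ) ≠ 0 := by positivity
        rw [eq_div_iff (by positivity)]
        linear_combination h2
      · intro j hj
        rw [Finset.mem_Icc] at hj
        rw [hmin j hj.1 (by omega)]
        ring
    exact ⟨L, hL, hΛ, ((isFrobeniusSolution_two_iff_of_resonance hβ hγ hL hΛ a).1 hsol).2⟩
  · rintro ⟨ha, h0, hz | ⟨L, hL, hΛ, h⟩⟩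
    · refine (isFrobeniusSolution_two_iff_recursion β Λ hγ a).2 ⟨ha, h0, fun l hl => ?_⟩
      rw [hz l hl, Finset.sum_eq_zero]
      · ring
      · intro j hj
        rw [hz j (Finset.mem_Icc.1 hj).1]
        ring
    · exact (isFrobeniusSolution_two_iff_of_resonance hβ hγ hL hΛ a).2 ⟨h0, h⟩

theorem existsUnique_isFrobeniusSolution_two {β γ Λ : ℝ} (hβ : β ≠ 0) (hγ : γ ≠ 0) {L : ℕ}
    (hL : 1 ≤ L) (hΛ : Λ = -γ / (6 * β * L * (L + 1))) (c : ℝ) :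
    ∃! a : ℕ → ℝ, IsFrobeniusSolution β γ Λ 2 a ∧ a L = c := by
  let G : ℕ → (ℕ → ℝ) → ℝ := fun n a =>
    if n = 0 then -Λ else if n < L then 0 else if n = L then c else
      6 * β * (∑ j ∈ Finset.Icc 1 (n - 1),
          a j * a (n - j) * ((j : ℝ) + 2) * ((j : ℝ) + 1) * (j : ℝ)) /
        (((n : ℝ) + 2) * (γ + 6 * β * Λ * n * (n + 1)))
  refine (existsUnique_congr fun a => ?_).1 (existsUnique_recursion G ?_)
  · rw [isFrobeniusSolution_two_iff_of_resonance hβ hγ hL hΛ]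
    constructor
    · intro h
      refine ⟨⟨by simpa [G] using h 0, fun i hi hiL => ?_, fun l hl => ?_⟩, ?_⟩
      · rw [h i]
        simp [G, hiL, show i ≠ 0 by omega]
      · rw [h l]
        simp only [G]
        rw [if_neg (by omega), if_neg (by omega), if_neg (by omega)]
      · rw [h L]
        simp [G, show L ≠ 0 by omega]
    · rintro ⟨⟨h0, hlt, hgt⟩, hc⟩ n
      simp only [G]
      split_ifs with h1 h2 h3
      · rw [h1, h0]
      · exact hlt n (by omega) h2
      · rw [h3, hc]
      · exact hgt n (by omega)
  · intro n a b hab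
    simp only [G]
    split_ifs with h1
    · rfl
    · rfl
    · rfl
    · congr 2
      refine Finset.sum_congr rfl fun j hj => ?_
      rw [Finset.mem_Icc] at hj
      rw [hab j (by omega), hab (n - j) (by omega)]

/-- If `L` does not divide `l`, it fails to divide `j` or `l - j`, so each product has a zero
factor. -/
theorem IsFrobeniusSolution.eq_zero_of_not_dvd {β γ Λ : ℝ} (hβ : β ≠ 0) (hγ : γ ≠ 0) {L : ℕ}
    (hL : 1 ≤ L) (hΛ : Λ = -γ / (6 * β * L * (L + 1))) {a : ℕ → ℝ}
    (h : IsFrobeniusSolution β γ Λ 2 a) (l : ℕ) (hl : ¬ L ∣ l) : a l = 0 := by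
  obtain ⟨-, hlt, hgt⟩ := (isFrobeniusSolution_two_iff_of_resonance hβ hγ hL hΛ a).1 h
  induction l using Nat.strong_induction_on with
  | _ l ih =>
    have hl0 : l ≠ 0 := fun h0 => hl (h0 ▸ dvd_zero L)
    have hlL : l ≠ L := fun h0 => hl (h0 ▸ dvd_rfl)
    rcases lt_or_gt_of_ne hlL with hlL | hlL
    · exact hlt l (by omega) hlL
    · rw [hgt l hlL, Finset.sum_eq_zero]
      · simp
      · intro j hj
        rw [Finset.mem_Icc] at hj
        by_cases hj' : L ∣ j
        · rw [ih (l - j) (by omega) fun h' => hl ?_]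
          · ring
          · have := Nat.dvd_add h' hj'
            rwa [Nat.sub_add_cancel (by omega)] at this
        · rw [ih j (by omega) hj']
          ring

/-- The coefficients at multiples of `L` have the signs of a geometric progression. -/
theorem IsFrobeniusSolution.pos_of_resonance {β γ Λ : ℝ} (hβ : β ≠ 0) (hγ : γ ≠ 0) {L : ℕ}
    (hL : 1 ≤ L) (hΛ : Λ = -γ / (6 * β * L * (L + 1))) {a : ℕ → ℝ}
    (h : IsFrobeniusSolution β γ Λ 2 a) (haL : a L ≠ 0) (k : ℕ) :
    0 < a ((k + 1) * L) * (a L * (-(β / γ) * a L) ^ k) := by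
  have hnd := h.eq_zero_of_not_dvd hβ hγ hL hΛ
  obtain ⟨-, hlt, hgt⟩ := (isFrobeniusSolution_two_iff_of_resonance hβ hγ hL hΛ a).1 h
  induction k using Nat.strong_induction_on with
  | _ k ih =>
    rcases k with _ | k
    · simpa using mul_self_pos.2 haL
    set q := -(β / γ) * a L with hq
    set l := (k + 1 + 1) * L with hl
    have hlL : L < l := by
      rw [hl]
      nlinarith
    have hterm : ∀ i, i ≤ k → 0 < a ((i + 1) * L) * a (l - (i + 1) * L) *
        -- With `i + m = k`, the product of the two induction hypotheses carries the sign weight `a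
        -- L ^ 2 * q ^ k`, independent of `i`: no cancellation can occur.
        (a L ^ 2 * q ^ k) := fun i hi => by
      obtain ⟨m, rfl⟩ := Nat.exists_eq_add_of_le hi
      have h1 : l - (i + 1) * L = (m + 1) * L := by
        rw [hl, ← Nat.sub_mul]
        congr 1
        omega
      rw [h1]
      have := mul_pos (ih i (by omega)) (ih m (by omega))
      rw [pow_add]
      calc _ < _ := this
        _ = _ := by ring
    have hS : 0 < (∑ j ∈ Finset.Icc 1 (l - 1),
        a j * a (l - j) * ((j : ℝ) + 2) * ((j : ℝ) + 1) * (j : ℝ)) * (a L ^ 2 * q ^ k) := by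
      rw [Finset.sum_mul]
      refine Finset.sum_pos' (fun j hj => ?_) ⟨L, Finset.mem_Icc.2 ⟨hL, by omega⟩, ?_⟩
      · rw [Finset.mem_Icc] at hj
        by_cases hj' : L ∣ j
        · obtain ⟨i, rfl⟩ := hj'
          rcases i with _ | i
          · simp
          have hi : i ≤ k := by
            have h1 : L * (i + 1) < L * (k + 1 + 1) := by
              rw [mul_comm L (k + 1 + 1), ← hl]
              omega
            have := lt_of_mul_lt_mul_left h1 (Nat.zero_le L)
            omega
          have := (hterm i hi).le
          rw [mul_comm L (i + 1)]
          calc (0 : ℝ) ≤ (a ((i + 1) * L) * a (l - (i + 1) * L) * (a L ^ 2 * q ^ k)) *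
                (((((i + 1) * L : ℕ) : ℝ) + 2) * ((((i + 1) * L : ℕ) : ℝ) + 1) *
                  (((i + 1) * L : ℕ) : ℝ)) := by positivity
            _ = _ := by ring
        · rw [hnd j hj']
          simp
      · have := hterm 0 (Nat.zero_le k)
        rw [zero_add, one_mul] at this
        have hL' : (0 : ℝ) < L := by positivity
        calc (0 : ℝ) < (a L * a (l - L) * (a L ^ 2 * q ^ k)) *
                (((L : ℝ) + 2) * ((L : ℝ) + 1) * L) := by positivity
            _ = _ := by ring
    have hL' : (0 : ℝ) < L := by positivity
    have hD : (0 : ℝ) < l * (l + 1) - L * (L + 1) := by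
      have h1 : (L : ℝ) < l := by exact_mod_cast hlL
      nlinarith
    rw [hgt l hlL, resonance_bracket hβ hL hΛ, pow_succ]
    set S := ∑ j ∈ Finset.Icc 1 (l - 1),
        a j * a (l - j) * ((j : ℝ) + 2) * ((j : ℝ) + 1) * (j : ℝ)
    have hD' : (L : ℝ) * (L + 1) - l * (l + 1) = -((l : ℝ) * (l + 1) - L * (L + 1)) := by ring
    rw [hD']
    set D := (l : ℝ) * (l + 1) - L * (L + 1)
    -- Expanding one factor `q` supplies the `-(β / γ)` that compensates the sign of the bracket and
    -- leaves a square.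
    have hfin : 6 * β * S / (((l : ℝ) + 2) * (γ * -D / (L * (L + 1)))) * (a L * (q ^ k * q)) =
        6 * (β / γ) ^ 2 * (S * (a L ^ 2 * q ^ k)) * (L * (L + 1)) / ((l + 2) * D) := by
      rw [show q ^ k * q = q ^ k * (-(β / γ) * a L) by rw [← hq]]
      field_simp
    rw [hfin]
    have : β / γ ≠ 0 := div_ne_zero hβ hγ
    positivity

theorem IsFrobeniusSolution.ne_zero_iff_dvd {β γ Λ : ℝ} (hβ : β ≠ 0) (hγ : γ ≠ 0) {L : ℕ}
    (hL : 1 ≤ L) (hΛ : Λ = -γ / (6 * β * L * (L + 1))) {a : ℕ → ℝ}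
    (h : IsFrobeniusSolution β γ Λ 2 a) (haL : a L ≠ 0) (l : ℕ) : a l ≠ 0 ↔ L ∣ l := by
  refine ⟨fun hl => not_not.1 fun hnd => hl (h.eq_zero_of_not_dvd hβ hγ hL hΛ l hnd), ?_⟩
  rintro ⟨k, rfl⟩
  rcases k with _ | k
  · exact h.1
  · rw [mul_comm]
    exact left_ne_zero_of_mul (h.pos_of_resonance hβ hγ hL hΛ haL k).ne'

/-! ### Reduction of the field equations -/

/-- For `α = 3β` the `tt` and `rr` components lose all dependence on `f` and become `6 R₀² γ (1 - Λ
R₀²)`, while `θθ` is `3 R₀⁴` times the reduced equation. Nonemptiness of `I` extracts the algebraic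
condition. -/
theorem fieldEquations_iff_reducedODE {α β : ℝ} (γ Λ : ℝ) (hα : α = 3 * β) {R₀ : ℝ}
    (f : ℝ → ℝ) {I : Set ℝ} (hR : 0 < R₀) (hI : I.Nonempty) :
    (∀ r ∈ I, fieldTT α β γ Λ R₀ f r = 0 ∧ fieldRR α β γ Λ R₀ f r = 0 ∧
        fieldThetaTheta α β γ Λ R₀ f r = 0) ↔
      (γ = 0 ∨ R₀ ^ 2 = 1 / Λ) ∧ ∀ r ∈ I, reducedODE β γ Λ f r = 0 := by
  subst hα
  have hTT : ∀ r, fieldTT (3 * β) β γ Λ R₀ f r = 6 * R₀ ^ 2 * (γ * (1 - Λ * R₀ ^ 2)) :=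
    fun r => by rw [fieldTT]; ring
  have hRR : ∀ r, fieldRR (3 * β) β γ Λ R₀ f r = 6 * R₀ ^ 2 * (γ * (1 - Λ * R₀ ^ 2)) :=
    fun r => by rw [fieldRR]; ring
  have hθ : ∀ r, fieldThetaTheta (3 * β) β γ Λ R₀ f r = 3 * R₀ ^ 4 * reducedODE β γ Λ f r :=
    fun r => by rw [fieldThetaTheta, reducedODE]; ring
  have hc : γ * (1 - Λ * R₀ ^ 2) = 0 ↔ γ = 0 ∨ R₀ ^ 2 = 1 / Λ := by
    rw [mul_eq_zero]
    refine or_congr_right ⟨fun h => ?_, fun h => ?_⟩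
    · have hΛ : Λ ≠ 0 := by
        rintro rfl
        simp at h
      rw [eq_div_iff hΛ]
      linarith
    -- Since `1 / 0 = 0`, the case `Λ = 0` would give `R₀ ^ 2 = 0`.
    · have hΛ : Λ ≠ 0 := by
        rintro rfl
        rw [div_zero] at h
        exact (pow_pos hR 2).ne' h
      rw [h]
      field_simp
      ring
  have h2 : 6 * R₀ ^ 2 ≠ 0 := by positivity
  have h4 : 3 * R₀ ^ 4 ≠ 0 := by positivity
  simp only [hTT, hRR, hθ, mul_eq_zero_iff_left h2, mul_eq_zero_iff_left h4, hc]
  obtain ⟨r, hr⟩ := hI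
  exact ⟨fun h => ⟨(h r hr).1, fun s hs => (h s hs).2.2⟩, fun h s hs => ⟨h.1, h.1, h.2 s hs⟩⟩

theorem mainTheorem5 (α β γ Λ : ℝ) (hα : α = 3 * β) :
    -- reduction of the field equations to the reduced equation
    (∀ (R₀ : ℝ) (f : ℝ → ℝ) (I : Set ℝ), 0 < R₀ → I.Nonempty →
      ((∀ r ∈ I, fieldTT α β γ Λ R₀ f r = 0 ∧ fieldRR α β γ Λ R₀ f r = 0 ∧
          fieldThetaTheta α β γ Λ R₀ f r = 0) ↔
        (γ = 0 ∨ R₀ ^ 2 = 1 / Λ) ∧ ∀ r ∈ I, reducedODE β γ Λ f r = 0)) ∧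
    -- a convergent series solves the equation as a function iff it does so formally
    (∀ (p r₀ ρ : ℝ) (a : ℕ → ℝ), 0 < ρ →
      (∀ x : ℝ, |x| < ρ → Summable fun i : ℕ => a i * x ^ i) →
      ((∀ r ∈ Set.Ioo r₀ (r₀ + ρ),
          reducedODE β γ Λ (fun s => (s - r₀) ^ p * ∑' i : ℕ, a i * (s - r₀) ^ i) r = 0) ↔
        formalReducedODE β γ Λ (frobeniusSeries p a) = 0)) ∧
    -- the indicial exponents
    (β ≠ 0 ∨ γ ≠ 0 → ∀ (p : ℝ) (a : ℕ → ℝ), IsFrobeniusSolution β γ Λ p a →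
      p = 0 ∨ p = 1 ∨ p = 3 / 2 ∨ p = 2) ∧
    -- the case p = 3/2
    (β ≠ 0 ∨ γ ≠ 0 → ∀ a : ℕ → ℝ,
      IsFrobeniusSolution β γ Λ (3 / 2) a ↔ a 0 ≠ 0 ∧ γ = 0 ∧ ∀ i, 1 ≤ i → a i = 0) ∧
    -- the case p = 2
    (β ≠ 0 → γ ≠ 0 →
      (∀ a : ℕ → ℝ, IsFrobeniusSolution β γ Λ 2 a ↔
        a 0 ≠ 0 ∧ a 0 = -Λ ∧
        ((∀ i, 1 ≤ i → a i = 0) ∨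
          ∃ L : ℕ, 1 ≤ L ∧ Λ = -γ / (6 * β * L * (L + 1)) ∧
            (∀ i, 1 ≤ i → i < L → a i = 0) ∧
            ∀ l : ℕ, L < l →
              a l = 6 * β * (∑ j ∈ Finset.Icc 1 (l - 1),
                  a j * a (l - j) * ((j : ℝ) + 2) * ((j : ℝ) + 1) * (j : ℝ)) /
                (((l : ℝ) + 2) * (γ + 6 * β * Λ * l * (l + 1))))) ∧
      (∀ L : ℕ, 1 ≤ L → Λ = -γ / (6 * β * L * (L + 1)) →
        (∀ l : ℕ, L < l → γ + 6 * β * Λ * l * (l + 1) ≠ 0) ∧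
        (∀ c : ℝ, ∃! a : ℕ → ℝ, IsFrobeniusSolution β γ Λ 2 a ∧ a L = c) ∧
        (∀ a : ℕ → ℝ, IsFrobeniusSolution β γ Λ 2 a → a L ≠ 0 →
          ∀ l : ℕ, a l ≠ 0 ↔ L ∣ l))) ∧
    -- the case p = 1
    (β ≠ 0 →
      (∀ a : ℕ → ℝ, IsFrobeniusSolution β γ Λ 1 a ↔
        a 0 ≠ 0 ∧ a 2 = γ * (a 1 + Λ) / (18 * β * a 0) ∧
        ∀ l : ℕ, 1 ≤ l →
          a (l + 2) = (γ * a (l + 1) * ((l : ℝ) + 2) -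
              6 * β * ∑ j ∈ Finset.Icc 1 (l + 1),
                a j * a (l + 2 - j) * (j : ℝ) * ((j : ℝ) + 1) * ((j : ℝ) - 1)) /
            (6 * β * a 0 * ((l : ℝ) + 3) * ((l : ℝ) + 2) * ((l : ℝ) + 1))) ∧
      (∀ c₀ c₁ : ℝ, c₀ ≠ 0 →
        ∃! a : ℕ → ℝ, IsFrobeniusSolution β γ Λ 1 a ∧ a 0 = c₀ ∧ a 1 = c₁) ∧
      (∀ a : ℕ → ℝ, IsFrobeniusSolution β γ Λ 1 a →
        a 3 = -(γ * (a 1 + Λ) * (12 * β * a 1 - γ) / (864 * β ^ 2 * a 0 ^ 2)) ∧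
        a 4 = γ * (a 1 + Λ) *
            (432 * β ^ 2 * a 1 ^ 2 - 72 * β * γ * a 1 + γ ^ 2 - 24 * β * γ * Λ) /
          (77760 * β ^ 3 * a 0 ^ 3) ∧
        (a 1 = -Λ ∨ γ = 0 → ∀ i, 2 ≤ i → a i = 0))) ∧
    -- the case p = 0
    (β ≠ 0 →
      (∀ a : ℕ → ℝ, IsFrobeniusSolution β γ Λ 0 a ↔
        a 0 ≠ 0 ∧ a 4 = -(a 1 * a 3 / (4 * a 0)) + γ * (a 2 + Λ) / (72 * β * a 0) ∧
        ∀ l : ℕ, 1 ≤ l →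
          a (l + 4) = (γ * a (l + 2) * ((l : ℝ) + 2) -
              6 * β * ∑ j ∈ Finset.Icc 1 (l + 3),
                a j * a (l + 4 - j) * (j : ℝ) * ((j : ℝ) - 1) * ((j : ℝ) - 2)) /
            (6 * β * a 0 * ((l : ℝ) + 4) * ((l : ℝ) + 3) * ((l : ℝ) + 2))) ∧
      (∀ c₀ c₁ c₂ c₃ : ℝ, c₀ ≠ 0 →
        ∃! a : ℕ → ℝ, IsFrobeniusSolution β γ Λ 0 a ∧
          a 0 = c₀ ∧ a 1 = c₁ ∧ a 2 = c₂ ∧ a 3 = c₃) ∧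
      (∀ a : ℕ → ℝ, IsFrobeniusSolution β γ Λ 0 a →
        a 5 = -(a 3 * (a 0 * a 2 - a 1 ^ 2) / (10 * a 0 ^ 2)) +
            γ * (3 * a 0 * a 3 - 2 * a 1 * (a 2 + Λ)) / (360 * β * a 0 ^ 2) ∧
        a 6 = -(a 3 ^ 2 / (20 * a 0)) +
            a 1 * a 3 * (9 * β * (2 * a 0 * a 2 - a 1 ^ 2) - γ * a 0) / (180 * β * a 0 ^ 3) -
            γ * (a 2 + Λ) * (36 * β * (a 0 * a 2 - a 1 ^ 2) - γ * a 0) /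
              (12960 * β ^ 2 * a 0 ^ 3) ∧
        (a 3 = 0 → a 2 = -Λ ∨ γ = 0 → ∀ i, 3 ≤ i → a i = 0))) := by

  refine ⟨fun R₀ f I hR hI => fieldEquations_iff_reducedODE γ Λ hα f hR hI,
    fun p r₀ ρ a hρ h => reducedODE_eq_zero_iff_formal β γ Λ p r₀ hρ h,
    fun h p a ha => ha.exponent h, isFrobeniusSolution_three_halves_iff Λ,
    fun hβ hγ => ⟨isFrobeniusSolution_two_iff Λ hβ hγ, fun L hL hΛ =>
      ⟨fun l hl => resonance_bracket_ne_zero hβ hγ hL hΛ hl.ne',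
        existsUnique_isFrobeniusSolution_two hβ hγ hL hΛ,
        fun a ha haL => ha.ne_zero_iff_dvd hβ hγ hL hΛ haL⟩⟩,
    fun hβ => ⟨isFrobeniusSolution_one_iff γ Λ hβ,
      fun c₀ c₁ hc => existsUnique_isFrobeniusSolution_one γ Λ hβ c₁ hc,
      fun a ha => ⟨ha.coeff_three_of_one hβ, ha.coeff_four_of_one hβ, ha.eq_zero_of_one hβ⟩⟩,
    fun hβ => ⟨isFrobeniusSolution_zero_iff γ Λ hβ,
      fun c₀ c₁ c₂ c₃ hc => existsUnique_isFrobeniusSolution_zero γ Λ hβ c₁ c₂ c₃ hc,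
      fun a ha => ⟨ha.coeff_five_of_zero hβ, ha.coeff_six_of_zero hβ, ha.eq_zero_of_zero hβ⟩⟩⟩
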